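/- **Setting.** Let $\mathcal H$ be a real Hilbert space, $A:\mathcal H\rightrightarrows\mathcal H$ a maximally monotone operator, $D:\mathcal H\to\mathcal H$ an $L_D^{-1}$-cocoercive and $B:\mathcal H\to\mathcal H$ an $L_B^{-1}$-cocoercive operator with $L_D,L_B>0$ (where $T$ is $c$-cocoercive if $\langle x-y,Tx-Ty\rangle\ge c\|Tx-Ty\|^2$ for all $x,y$). Put $C=\operatorname{zer}B=\{x: Bx=0\}$, let $N_C$ be its normal cone operator, $\sigma_C(u)=\sup_{y\in C}\langle y,u\rangle$ its support function, $\varphi_B(x,u)=\sup_{y\in\mathcal H}\{\langle x,By\rangle+\langle y,u\rangle-\langle y,By\rangle\}$ the Fitzpatrick function of $B$, and $J_{\mu A}=(\mathrm{Id}+\mu A)^{-1}$ the resolvent. Let $\gamma,\lambda,\beta:[0,+\infty)\to(0,+\infty)$ and $u_0,v_0\in\mathcal H$. A *strong global solution* of $$\ddot x(t)+\gamma(t)\dot x(t)+x(t)=J_{\lambda(t)A}\big(x(t)-\lambda(t)D(x(t))-\lambda(t)\beta(t)B(x(t))\big),\qquad x(0)=u_0,\ \dot x(0)=v_0,$$ is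 a map $x:[0,+\infty)\to\mathcal H$ such that $x$ and $\dot x$ are absolutely continuous on each $[0,b]$, $0<b<+\infty$, the equation holds for almost every $t\ge0$, and the initial conditions hold. **Theorem 2.** Assume - (H1) $\gamma,\lambda,\beta$ are continuous on each $[0,b]$, $0<b<+\infty$; - (H2) $A+N_C$ is maximally monotone and $\operatorname{zer}(A+D+N_C)\ne\emptyset$; - (H3) $\lambda\in L^2([0,+\infty))\setminus L^1([0,+\infty))$ and $\lim_{t\to+\infty}\lambda(t)=0$; - (H$_{fitz}$) for every $p\in\operatorname{ran}N_C$, $\displaystyle\int_0^{+\infty}\lambda(t)\beta(t)\Big(\sup_{u\in C}\varphi_B\big(u,\tfrac{p}{\beta(t)}\big)-\sigma_C\big(\tfrac{p}{\beta(t)}\big)\Big)dt<+\infty$; and moreover $\limsup_{t\to+\infty}\lambda(t)\beta(t)<1/L_B$, $\gamma$ is absolutely continuous on each $[0,b]$, $0<b<+\infty$, and $\gamma(t)\ge\sqrt2$ and $\dot\gamma(t)\le0$ for almost every $t\ge0$. Let $x$ be the strong global solution of the system above, and let $\tilde x(t)=\frac{1}{\int_0^t\lambda(s)ds}\int_0^t\lambda(s)x(s)\,ds$.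 Then: (i) for every $x^*\in\operatorname{zer}(A+D+N_C)$, $\|x(t)-x^*\|$ converges as $t\to+\infty$; in addition, $\dot x,\ddot x\in L^2([0,+\infty),\mathcal H)$, $\lambda(\cdot)\beta(\cdot)\|B(x(\cdot))\|^2\in L^1([0,+\infty))$, $\int_0^{+\infty}\lambda(t)\beta(t)\langle B(x(t)),x(t)-x^*\rangle dt<+\infty$, and $\lim_{t\to+\infty}\dot x(t)=0$, $\lim_{t\to+\infty}\dot h(t)=0$, where $h(t)=\frac12\|x(t)-x^*\|^2$; (ii) $\tilde x(t)$ converges weakly as $t\to+\infty$ to an element of $\operatorname{zer}(A+D+N_C)$; (iii) if, additionally, $A$ is strongly monotone (there is $\eta>0$ with $\langle u-v,x-y\rangle\ge\eta\|x-y\|^2$ for all $u\in Ax$, $v\in Ay$), then $\operatorname{zer}(A+D+N_C)$ has exactly one element and $x(t)$ converges strongly to it as $t\to+\infty$. -/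

import Mathlib

open Set Filter Topology MeasureTheory
open scoped Pointwise ENNReal

namespace SecondOrderDyn

section Operators

variable {H : Type*} [NormedAddCommGroup H] [InnerProductSpace ℝ H]

/-- Monotonicity of a set-valued operator `A : H ⇉ H`. -/
def MonotoneOp (A : H → Set H) : Prop :=
  ∀ x y : H, ∀ u ∈ A x, ∀ v ∈ A y, 0 ≤ inner ℝ (x - y) (u - v)

/-- Maximal monotonicity: `A` is monotone and its graph has no proper monotone extension.
The order on `H → Set H` is pointwise inclusion, that is, inclusion of graphs. -/
def MaximallyMonotone (A : H → Set H) : Prop :=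
  Maximal (MonotoneOp (H := H)) A

/-- Strong monotonicity of a set-valued operator, with some modulus `η > 0`. -/
def StronglyMonotone (A : H → Set H) : Prop :=
  ∃ η : ℝ, 0 < η ∧
    ∀ x y : H, ∀ u ∈ A x, ∀ v ∈ A y, η * ‖x - y‖ ^ 2 ≤ inner ℝ (x - y) (u - v)

/-- `c`-cocoercivity of a single-valued operator. -/
def Cocoercive (c : ℝ) (T : H → H) : Prop :=
  ∀ x y : H, c * ‖T x - T y‖ ^ 2 ≤ inner ℝ (x - y) (T x - T y)

/-- The set of zeros of a set-valued operator. -/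
def zer (A : H → Set H) : Set H := {x | (0 : H) ∈ A x}

/-- The range of a set-valued operator. -/
def ran (A : H → Set H) : Set H := {u | ∃ x, u ∈ A x}

/-- A single-valued operator, regarded as a set-valued one. -/
def single (T : H → H) : H → Set H := fun x => {T x}

/-- The normal cone operator of a set `S`; it is empty at the points outside `S`. -/
def normalCone (S : Set H) : H → Set H :=
  fun x => {u | x ∈ S ∧ ∀ y ∈ S, inner ℝ (y - x) u ≤ 0}

/-- The resolvent `J_A` of `A`, as a set-valued operator: `p ∈ J_A x` iff `x ∈ p + A p`.
For maximally monotone `A` the set `J_A x` has exactly one element. -/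
def resolventOp (A : H → Set H) : H → Set H :=
  fun x => {p | x ∈ ({p} : Set H) + A p}

/-- The support function of a set. -/
noncomputable def supportFun (S : Set H) (u : H) : EReal :=
  ⨆ y ∈ S, ((inner ℝ y u : ℝ) : EReal)

/-- The Fitzpatrick function of a set-valued operator. -/
noncomputable def fitzpatrick (A : H → Set H) (x u : H) : EReal :=
  ⨆ y : H, ⨆ v ∈ A y, ((inner ℝ x v + inner ℝ y u - inner ℝ y v : ℝ) : EReal)

/-- The Fitzpatrick gap `sup_{u ∈ C} φ_B(u, q) - σ_C(q)`, where `C = zer B`. -/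
noncomputable def fitzGap (B : H → H) (q : H) : EReal :=
  (⨆ u ∈ zer (single B), fitzpatrick (single B) u q) - supportFun (zer (single B)) q

/-- The integral condition on the Fitzpatrick gap, for every `p` in the range of the normal cone of
`C = zer B`. For such `p` the support function is finite at `p / β(t)` and the gap lies in
`[0, +∞]` (because `φ_B(u, q) ≥ ⟨u, q⟩` for `u ∈ C`), so nothing is lost by integrating in `ℝ≥0∞`. -/
def FitzCondition (B : H → H) (lam β : ℝ → ℝ) : Prop :=
  ∀ p ∈ ran (normalCone (zer (single B))),
    ∫⁻ t in Ici (0 : ℝ),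
      ENNReal.ofReal (lam t * β t) * (fitzGap B ((β t)⁻¹ • p)).toENNReal < ⊤

end Operators

section Trajectories

variable {E : Type*} [NormedAddCommGroup E] [NormedSpace ℝ E]

/-- Time derivative of a function on `[0, +∞)` (one-sided at `0`). -/
noncomputable def timeDeriv (f : ℝ → E) : ℝ → E := fun t => derivWithin f (Ici 0) t

/-- Local absolute continuity on `[0, +∞)`: absolute continuity on each `[0, b]`. -/
def LocallyAC (f : ℝ → E) : Prop :=
  ∀ b : ℝ, 0 < b → AbsolutelyContinuousOnInterval f 0 b

/-- The weighted ergodic average `(∫₀ᵗ λ)⁻¹ ∫₀ᵗ λ(s) x(s) ds`. -/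
noncomputable def ergodicAverage (lam : ℝ → ℝ) (x : ℝ → E) (t : ℝ) : E :=
  (∫ s in (0 : ℝ)..t, lam s)⁻¹ • ∫ s in (0 : ℝ)..t, lam s • x s

end Trajectories

/-- Strong global solutions `x : [0, +∞) → H` of
`x'' + γ x' + x = J_{λ A} (x - λ D x - λ β B x)`, `x(0) = u₀`, `x'(0) = v₀`
(only the values of `x` on `[0, +∞)` matter). The second derivative is required to exist for
almost every `t ≥ 0`. -/
structure IsStrongGlobalSolution {H : Type*} [NormedAddCommGroup H] [InnerProductSpace ℝ H]
    (A : H → Set H) (D B : H → H) (γ lam β : ℝ → ℝ) (u₀ v₀ : H) (x : ℝ → H) : Prop where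
  differentiable : DifferentiableOn ℝ x (Ici 0)
  locallyAC : LocallyAC x
  locallyAC_deriv : LocallyAC (timeDeriv x)
  equation : ∀ᵐ t ∂(volume.restrict (Ici (0 : ℝ))),
    DifferentiableWithinAt ℝ (timeDeriv x) (Ici 0) t ∧
    timeDeriv (timeDeriv x) t + γ t • timeDeriv x t + x t ∈
      resolventOp (fun y => lam t • A y) (x t - lam t • D (x t) - (lam t * β t) • B (x t))
  initial_position : x 0 = u₀
  initial_velocity : timeDeriv x 0 = v₀

end SecondOrderDyn

open SecondOrderDyn

/-! Write y = x'' + γx'. The equation says that (−y − λDx − λβBx)/λ lies in A(y + x). Fix a graph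
point w = v + Dz + p of A + D + N_C with v ∈ Az and p ∈ N_C(z), and test the monotonicity of A
against (z, v). Once λL_D ≤ 1/8 and λβL_B ≤ 1, Young's inequality and the cocoercivity of D and B
absorb the cross terms (`penalized_inclusion_estimate`), leaving (9/16)‖y‖² + ⟨x − z, y⟩ ≤ `forcing`
+ λ⟨z − x, w⟩. Here `forcing` consists of a λ² term and a positive part dominated by the Fitzpatrick
gap at 8p/β, so it is integrable. The left side dominates the derivative of `energy` plus multiples
of ‖x''‖² and ‖x'‖²; this is where γ² ≥ 2 and γ' ≤ 0 enter (`deriv_energy_le`).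

For w = 0 this is a Lyapunov inequality: the energy converges, the dissipation is integrable, and x'
→ 0. As γ decreases to a limit at least √2, ‖x − z‖ converges for every zero z.

For general w, integrating and dividing by ∫λ → ∞ shows that a weak cluster point b of the averages
satisfies ⟨z − b, w⟩ ≥ 0 on the whole graph of A + D + N_C. Since A + N_C is maximally monotone and
D cocoercive, b is a zero. Convergence of ‖x − a‖ at all zeros a then yields a unique cluster point,
as in Opial's lemma.

When A is strongly monotone, the dissipation also controls λ‖x − z‖², and λ ∉ L¹ forces the limit of
‖x − z‖ to be 0.

Maximality at a zero is exploited through Minty's theorem, obtained by minimizing the Fitzpatrick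
function plus half the squared norm. -/

namespace SecondOrderDyn

/-! ### Maximal monotonicity, Minty's theorem and cocoercive perturbations. -/

section Operators

variable {H : Type*} [NormedAddCommGroup H] [InnerProductSpace ℝ H]

/-- Adjoining (x, u) to the graph preserves monotonicity, so by maximality the point was already
there. -/
theorem MaximallyMonotone.mem_of_forall {A : H → Set H} (hA : MaximallyMonotone A) {x u : H}
    (h : ∀ y, ∀ v ∈ A y, 0 ≤ inner ℝ (x - y) (u - v)) : u ∈ A x := by
  have hmono : MonotoneOp fun y => A y ∪ {v | y = x ∧ v = u} := by
    rintro a b u' (hu' | ⟨rfl, rfl⟩) v' (hv' | ⟨rfl, rfl⟩)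
    · exact hA.1 a b u' hu' v' hv'
    · have := h a u' hu'
      rwa [← neg_sub a, ← neg_sub u', inner_neg_neg] at this
    · exact h b v' hv'
    · simp
  exact hA.2 hmono (fun y => subset_union_left) x (Or.inr ⟨rfl, rfl⟩)

theorem MaximallyMonotone.exists_mem {A : H → Set H} (hA : MaximallyMonotone A) :
    ∃ y v, v ∈ A y := by
  by_contra! hne
  exact hne 0 0 (hA.mem_of_forall fun y v hv => (hne y v hv).elim)

/-- `r` is an upper bound of the Fitzpatrick function of `A` at `(x, u)`. -/
def FitzpatrickLE (A : H → Set H) (x u : H) (r : ℝ) : Prop :=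
  ∀ y, ∀ v ∈ A y, inner ℝ x v + inner ℝ y u - inner ℝ y v ≤ r

/-- If r < ⟨x, u⟩, the bound makes (x, u) monotonically related to the graph, hence a point of it;
the bound at that very point is then contradictory. -/
theorem FitzpatrickLE.inner_le {A : H → Set H} (hA : MaximallyMonotone A) {x u : H} {r : ℝ}
    (h : FitzpatrickLE A x u r) : inner ℝ x u ≤ r := by
  by_contra! hlt
  have hmem : u ∈ A x := hA.mem_of_forall fun y v hv => by
    have := h y v hv
    simp only [inner_sub_left, inner_sub_right]
    linarith
  have := h x u hmem
  linarith

theorem MonotoneOp.fitzpatrickLE {A : H → Set H} (hA : MonotoneOp A) {x u : H} (hu : u ∈ A x) :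
    FitzpatrickLE A x u (inner ℝ x u) := fun y v hv => by
  have := hA x y u hu v hv
  simp only [inner_sub_left, inner_sub_right] at this
  linarith

theorem FitzpatrickLE.convexComb {A : H → Set H} {x u x' u' : H} {r r' : ℝ}
    (h : FitzpatrickLE A x u r) (h' : FitzpatrickLE A x' u' r') {s : ℝ} (hs : 0 ≤ s)
    (hs1 : s ≤ 1) :
    FitzpatrickLE A (x + s • (x' - x)) (u + s • (u' - u)) (r + s * (r' - r)) := fun y v hv => by
  have h1 := mul_le_mul_of_nonneg_left (h y v hv) (sub_nonneg.2 hs1)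
  have h2 := mul_le_mul_of_nonneg_left (h' y v hv) hs
  simp only [inner_add_left, inner_add_right, inner_sub_left, inner_sub_right,
    real_inner_smul_left, real_inner_smul_right]
  linarith

theorem norm_add_smul_sub_sq (x x' : H) (s : ℝ) :
    ‖x + s • (x' - x)‖ ^ 2 = ‖x‖ ^ 2 + 2 * s * inner ℝ x (x' - x) + s ^ 2 * ‖x' - x‖ ^ 2 := by
  rw [norm_add_sq_real, norm_smul, real_inner_smul_right, mul_pow, Real.norm_eq_abs, sq_abs]
  ring

theorem norm_midpoint_sq (x x' : H) :
    ‖x + (1 / 2 : ℝ) • (x' - x)‖ ^ 2 = ‖x‖ ^ 2 / 2 + ‖x'‖ ^ 2 / 2 - ‖x - x'‖ ^ 2 / 4 := by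
  rw [norm_add_smul_sub_sq, norm_sub_rev x x', norm_sub_sq_real x' x, inner_sub_right,
    real_inner_self_eq_norm_sq, real_inner_comm x x']
  ring

/-- The strongly convex function `φ_A + ½ ‖(·, ·)‖²` attains its infimum. -/
theorem MaximallyMonotone.exists_fitzpatrick_minimizer [CompleteSpace H] {A : H → Set H}
    (hA : MaximallyMonotone A) :
    ∃ x u r, FitzpatrickLE A x u r ∧ ∀ x' u' r', FitzpatrickLE A x' u' r' →
      r + ‖x‖ ^ 2 / 2 + ‖u‖ ^ 2 / 2 ≤ r' + ‖x'‖ ^ 2 / 2 + ‖u'‖ ^ 2 / 2 := by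
  set S : Set ℝ := {c | ∃ x u r, FitzpatrickLE A x u r ∧ c = r + ‖x‖ ^ 2 / 2 + ‖u‖ ^ 2 / 2}
    with hS
  -- Since r ≥ ⟨x, u⟩, each value is at least ‖x + u‖²/2.
  have hbdd : BddBelow S := by
    refine ⟨0, ?_⟩
    rintro c ⟨x, u, r, h, rfl⟩
    have h1 := h.inner_le hA
    have h2 := norm_add_sq_real x u
    nlinarith [sq_nonneg ‖x + u‖]
  have hne : S.Nonempty := by
    obtain ⟨y, v, hv⟩ := hA.exists_mem
    exact ⟨_, y, v, _, hA.1.fitzpatrickLE hv, rfl⟩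
  have hmin : ∀ x' u' r', FitzpatrickLE A x' u' r' →
      sInf S ≤ r' + ‖x'‖ ^ 2 / 2 + ‖u'‖ ^ 2 / 2 :=
    fun x' u' r' h => csInf_le hbdd ⟨x', u', r', h, rfl⟩
  obtain ⟨c, -, hc_lim, hc_mem⟩ := exists_seq_tendsto_sInf hne hbdd
  choose x u r hK hc using hc_mem
  -- Compare the infimum with the value at the midpoint: the parallelogram identity turns strong
  -- convexity into a Cauchy estimate.
  have hdist : ∀ m n, ‖x m - x n‖ ^ 2 + ‖u m - u n‖ ^ 2 ≤ 4 * (c m + c n - 2 * sInf S) := by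
    intro m n
    have h1 := hmin _ _ _ ((hK m).convexComb (hK n) (s := 1 / 2) (by norm_num) (by norm_num))
    rw [norm_midpoint_sq, norm_midpoint_sq] at h1
    rw [hc m, hc n]
    linarith
  have hcauchy : ∀ f : ℕ → H, (∀ m n, ‖f m - f n‖ ^ 2 ≤ 4 * (c m + c n - 2 * sInf S)) →
      CauchySeq f := by
    intro f hf
    rw [Metric.cauchySeq_iff]
    intro ε hε
    have hev : ∀ᶠ n in atTop, c n < sInf S + ε ^ 2 / 8 :=
      hc_lim.eventually_lt_const (by have := pow_pos hε 2; linarith)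
    obtain ⟨N, hN⟩ := eventually_atTop.1 hev
    refine ⟨N, fun m hm n hn => ?_⟩
    rw [dist_eq_norm]
    refine lt_of_pow_lt_pow_left₀ 2 hε.le ?_
    have := hf m n
    have := hN m hm
    have := hN n hn
    linarith
  obtain ⟨x₀, hx₀⟩ := cauchySeq_tendsto_of_complete
    (hcauchy x fun m n => by have := hdist m n; have := sq_nonneg ‖u m - u n‖; linarith)
  obtain ⟨u₀, hu₀⟩ := cauchySeq_tendsto_of_complete
    (hcauchy u fun m n => by have := hdist m n; have := sq_nonneg ‖x m - x n‖; linarith)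
  have hr : Tendsto r atTop (𝓝 (sInf S - ‖x₀‖ ^ 2 / 2 - ‖u₀‖ ^ 2 / 2)) := by
    have := (hc_lim.sub ((hx₀.norm.pow 2).div_const 2)).sub ((hu₀.norm.pow 2).div_const 2)
    refine this.congr fun n => ?_
    rw [hc n]
    ring
  refine ⟨x₀, u₀, sInf S - ‖x₀‖ ^ 2 / 2 - ‖u₀‖ ^ 2 / 2, fun y v hv => ?_, fun x' u' r' h => ?_⟩
  · refine le_of_tendsto_of_tendsto' (((hx₀.inner tendsto_const_nhds).add
      (tendsto_const_nhds.inner hu₀)).sub_const _) hr fun n => hK n y v hv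
  · have := hmin x' u' r' h
    linarith

theorem nonneg_of_forall_quadratic {a b : ℝ} (h : ∀ s : ℝ, 0 < s → s ≤ 1 → 0 ≤ s * a + s ^ 2 * b) :
    0 ≤ a := by
  have hlim : Tendsto (fun s : ℝ => a + s * b) (𝓝[>] 0) (𝓝 a) := by
    have : Tendsto (fun s : ℝ => a + s * b) (𝓝 0) (𝓝 (a + 0 * b)) :=
      Continuous.tendsto (by fun_prop) 0
    rw [zero_mul, add_zero] at this
    exact this.mono_left nhdsWithin_le_nhds
  refine ge_of_tendsto hlim ?_
  filter_upwards [Ioc_mem_nhdsGT (zero_lt_one' ℝ)] with s hs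
  have := h s hs.1 hs.2
  have h2 : 0 ≤ s * (a + s * b) := by linarith
  exact nonneg_of_mul_nonneg_right h2 hs.1

/-- Optimality of the minimizer (x, u) makes (−u, −x) monotonically related to the graph, hence a
point of it; testing optimality at that point gives u = −x. -/
theorem MaximallyMonotone.exists_neg_mem [CompleteSpace H] {A : H → Set H}
    (hA : MaximallyMonotone A) : ∃ x, -x ∈ A x := by
  obtain ⟨x, u, r, hK, hmin⟩ := hA.exists_fitzpatrick_minimizer
  have hr := hK.inner_le hA
  have hopt : ∀ y, ∀ v ∈ A y, ‖x + u‖ ^ 2 ≤ inner ℝ (y + u) (v + x) := by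
    intro y v hv
    -- First variation of the minimum along the segment towards (y, v, ⟨y, v⟩), a point of the
    -- epigraph because (y, v) is in the graph.
    have h1 : 0 ≤ (inner ℝ y v - r) + inner ℝ x (y - x) + inner ℝ u (v - u) := by
      refine nonneg_of_forall_quadratic (b := ‖y - x‖ ^ 2 / 2 + ‖v - u‖ ^ 2 / 2)
        fun s hs hs1 => ?_
      have := hmin _ _ _ (hK.convexComb (hA.1.fitzpatrickLE hv) hs.le hs1)
      rw [norm_add_smul_sub_sq, norm_add_smul_sub_sq] at this
      linarith
    rw [norm_add_sq_real]
    simp only [inner_sub_right, inner_add_left, inner_add_right,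
      real_inner_self_eq_norm_sq] at h1 ⊢
    rw [real_inner_comm x y, real_inner_comm x u]
    linarith
  have hmem : -x ∈ A (-u) := hA.mem_of_forall fun y v hv => by
    have := hopt y v hv
    rw [show -u - y = -(y + u) by abel, show -x - v = -(v + x) by abel, inner_neg_neg]
    exact (sq_nonneg _).trans this
  have h0 := hopt _ _ hmem
  have hxu : x + u = 0 := by
    rw [neg_add_cancel, inner_zero_left] at h0
    simpa using le_antisymm h0 (sq_nonneg _)
  rw [neg_eq_of_add_eq_zero_left hxu] at hmem
  exact ⟨x, hmem⟩

/-- **Minty's theorem**: `c ∈ ran (Id + μ A)`. -/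
theorem MaximallyMonotone.exists_resolvent [CompleteSpace H] {A : H → Set H}
    (hA : MaximallyMonotone A) {μ : ℝ} (hμ : 0 < μ) (c : H) : ∃ x, μ⁻¹ • (c - x) ∈ A x := by
  -- This operator is μA − c; a point x with −x in its value at x solves the resolvent inclusion.
  have hA' : MaximallyMonotone fun y => {v | μ⁻¹ • (v + c) ∈ A y} := by
    refine ⟨fun x y u hu v hv => ?_, fun A₁ hA₁ hle y v hv => ?_⟩
    · have := hA.1 x y _ hu _ hv
      rw [← smul_sub, add_sub_add_right_eq_sub, real_inner_smul_right] at this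
      exact nonneg_of_mul_nonneg_right this (inv_pos.2 hμ)
    · refine hA.mem_of_forall fun y' v' hv' => ?_
      have hmem : μ • v' - c ∈ A₁ y' := by
        refine hle y' ?_
        rwa [mem_ofPred_eq, sub_add_cancel, smul_smul, inv_mul_cancel₀ hμ.ne', one_smul]
      have := mul_nonneg (inv_pos.2 hμ).le (hA₁ y y' v hv _ hmem)
      rw [← real_inner_smul_right] at this
      rwa [show μ⁻¹ • (v - (μ • v' - c)) = μ⁻¹ • (v + c) - v' by
        rw [smul_sub, smul_sub, smul_smul, inv_mul_cancel₀ hμ.ne', one_smul, smul_add]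
        abel] at this
  obtain ⟨x, hx⟩ := hA'.exists_neg_mem
  refine ⟨x, ?_⟩
  rwa [mem_ofPred_eq, neg_add_eq_sub] at hx

theorem Cocoercive.inner_nonneg {c : ℝ} {T : H → H} (hT : Cocoercive c T) (hc : 0 ≤ c) (x y : H) :
    0 ≤ inner ℝ (x - y) (T x - T y) :=
  (mul_nonneg hc (sq_nonneg _)).trans (hT x y)

theorem Cocoercive.norm_sub_le {L : ℝ} {T : H → H} (hL : 0 < L) (hT : Cocoercive L⁻¹ T)
    (x y : H) : ‖T x - T y‖ ≤ L * ‖x - y‖ := by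
  have h1 := (hT x y).trans (real_inner_le_norm _ _)
  rcases (norm_nonneg (T x - T y)).eq_or_lt with h0 | h0
  · rw [← h0]
    positivity
  · have h2 : L⁻¹ * ‖T x - T y‖ ≤ ‖x - y‖ := by
      refine le_of_mul_le_mul_right ?_ h0
      linarith
    rwa [inv_mul_le_iff₀ hL] at h2

theorem Cocoercive.continuous {L : ℝ} {T : H → H} (hL : 0 < L) (hT : Cocoercive L⁻¹ T) :
    Continuous T :=
  (LipschitzWith.of_dist_le_mul (K := ⟨L, hL.le⟩) fun x y => by
    rw [dist_eq_norm, dist_eq_norm]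
    exact hT.norm_sub_le hL x y).continuous

/-- Maximality of the sum of a maximally monotone and a cocoercive operator, at a zero. -/
theorem MaximallyMonotone.neg_mem_of_forall_add_cocoercive [CompleteSpace H] {T : H → Set H}
    (hT : MaximallyMonotone T) {D : H → H} {L : ℝ} (hL : 0 < L) (hD : Cocoercive L⁻¹ D) {x : H}
    (h : ∀ z, ∀ w ∈ T z, 0 ≤ inner ℝ (z - x) (w + D z)) : -D x ∈ T x := by
  -- Test at z = J_{μT}(x − μDx). The step 1/(2L) yields −2L‖z − x‖², which outweighs the Lipschitz
  -- error L‖z − x‖², so z = x.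
  set μ : ℝ := (2 * L)⁻¹ with hμ
  have hμ0 : 0 < μ := by positivity
  obtain ⟨z, hz⟩ := hT.exists_resolvent hμ0 (x - μ • D x)
  have hw : μ⁻¹ • (x - μ • D x - z) + D z = -((2 * L) • (z - x)) + (D z - D x) := by
    rw [hμ, inv_inv, smul_sub, smul_sub, smul_smul, mul_inv_cancel₀ (by positivity), one_smul,
      smul_sub]
    abel
  have h1 := h z _ hz
  rw [hw, inner_add_right, inner_neg_right, real_inner_smul_right, real_inner_self_eq_norm_sq]
    at h1
  have h2 : inner ℝ (z - x) (D z - D x) ≤ L * ‖z - x‖ ^ 2 := by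
    have := (real_inner_le_norm (z - x) (D z - D x)).trans
      (mul_le_mul_of_nonneg_left (hD.norm_sub_le hL z x) (norm_nonneg _))
    linarith
  have h3 : ‖z - x‖ ^ 2 = 0 := by
    have : L * ‖z - x‖ ^ 2 ≤ 0 := by linarith
    nlinarith [sq_nonneg ‖z - x‖]
  have hzx : z = x := by simpa [sub_eq_zero] using h3
  rw [hzx, sub_right_comm, sub_self, zero_sub, smul_neg, smul_smul, inv_mul_cancel₀ hμ0.ne',
    one_smul] at hz
  exact hz

end Operators

/-! ### Weak cluster points and Opial's lemma. -/

section WeakConvergence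

variable {H : Type*} [NormedAddCommGroup H] [InnerProductSpace ℝ H]

/-- Along an ultrafilter each bounded scalar function ⟨y, w⟩ converges; the limit is a bounded
linear functional of w, represented by Riesz. -/
theorem exists_weak_limit_of_ultrafilter [CompleteSpace H] {α : Type*} (𝒰 : Ultrafilter α)
    {y : α → H} {R : ℝ} (hR : ∀ᶠ a in 𝒰, ‖y a‖ ≤ R) :
    ∃ b : H, ∀ w, Tendsto (fun a => inner ℝ (y a) w) 𝒰 (𝓝 (inner ℝ b w)) := by
  have hlim : ∀ w, ∃ c : ℝ, |c| ≤ R * ‖w‖ ∧ Tendsto (fun a => inner ℝ (y a) w) 𝒰 (𝓝 c) := by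
    intro w
    have hmem : ∀ᶠ a in 𝒰, inner ℝ (y a) w ∈ Icc (-(R * ‖w‖)) (R * ‖w‖) := by
      filter_upwards [hR] with a ha
      exact abs_le.1 ((abs_real_inner_le_norm _ _).trans
        (mul_le_mul_of_nonneg_right ha (norm_nonneg _)))
    obtain ⟨c, hc, hle⟩ := isCompact_Icc.ultrafilter_le_nhds
      (𝒰.map fun a => inner ℝ (y a) w) (le_principal_iff.2 hmem)
    exact ⟨c, abs_le.2 hc, hle⟩
  choose f hf hlim using hlim
  let F : H →ₗ[ℝ] ℝ :=
    { toFun := f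
      map_add' := fun v w => tendsto_nhds_unique (hlim (v + w)) <|
        ((hlim v).add (hlim w)).congr fun a => (inner_add_right _ _ _).symm
      map_smul' := fun c w => tendsto_nhds_unique (hlim (c • w)) <|
        ((hlim w).const_mul c).congr fun a => (real_inner_smul_right _ _ _).symm }
  refine ⟨(InnerProductSpace.toDual ℝ H).symm (F.mkContinuous R hf), fun w => ?_⟩
  rw [InnerProductSpace.toDual_symm_apply]
  exact hlim w

/-- **Opial's lemma**: if every weak cluster point of a bounded net lies in `S` and
`⟪y, a - b⟫` converges for all `a, b ∈ S`, then the net converges weakly to a point of `S`. -/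
theorem exists_weak_limit_of_cluster [CompleteSpace H] {α : Type*} {l : Filter α} [l.NeBot]
    {y : α → H} {R : ℝ} {S : Set H} (hR : ∀ᶠ a in l, ‖y a‖ ≤ R)
    (hS : ∀ 𝒰 : Ultrafilter α, (𝒰 : Filter α) ≤ l → ∀ b : H,
      (∀ w, Tendsto (fun a => inner ℝ (y a) w) 𝒰 (𝓝 (inner ℝ b w))) → b ∈ S)
    (hdiff : ∀ a ∈ S, ∀ b ∈ S, ∃ c, Tendsto (fun t => inner ℝ (y t) (a - b)) l (𝓝 c)) :
    ∃ z ∈ S, ∀ w, Tendsto (fun a => inner ℝ (y a) w) l (𝓝 (inner ℝ z w)) := by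
  have hex : ∀ 𝒰 : Ultrafilter α, (𝒰 : Filter α) ≤ l → ∃ b ∈ S,
      ∀ w, Tendsto (fun a => inner ℝ (y a) w) 𝒰 (𝓝 (inner ℝ b w)) := fun 𝒰 h𝒰 => by
    obtain ⟨b, hb⟩ := exists_weak_limit_of_ultrafilter 𝒰 (hR.filter_mono h𝒰)
    exact ⟨b, hS 𝒰 h𝒰 b hb, hb⟩
  obtain ⟨z, hz, hzlim⟩ := hex (Ultrafilter.of l) (Ultrafilter.of_le l)
  refine ⟨z, hz, fun w => (tendsto_iff_ultrafilter _ _ _).2 fun 𝒰 h𝒰 => ?_⟩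
  obtain ⟨b, hb, hblim⟩ := hex 𝒰 h𝒰
  obtain ⟨c, hc⟩ := hdiff z hz b hb
  -- The full limit c of ⟨y, z − b⟩ equals both ⟨z, z − b⟩ and ⟨b, z − b⟩, so ‖z − b‖² = 0.
  have h1 := tendsto_nhds_unique (hzlim (z - b)) (hc.mono_left (Ultrafilter.of_le l))
  have h2 := tendsto_nhds_unique (hblim (z - b)) (hc.mono_left h𝒰)
  have h3 : z = b := by
    rw [← sub_eq_zero, ← inner_self_eq_zero (𝕜 := ℝ), inner_sub_left, h1, h2, sub_self]
  rw [h3]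
  exact hblim w

theorem tendsto_toWeakSpace_of_inner [CompleteSpace H] {α : Type*} {l : Filter α} {y : α → H}
    {z : H} (h : ∀ w, Tendsto (fun a => inner ℝ (y a) w) l (𝓝 (inner ℝ z w))) :
    Tendsto (fun a => toWeakSpace ℝ H (y a)) l (𝓝 (toWeakSpace ℝ H z)) := by
  refine (WeakBilin.tendsto_iff_forall_eval_tendsto (B := (topDualPairing ℝ H).flip) ?_).2
    fun f => ?_
  -- The evaluation criterion needs the pairing to separate points.
  · intro a b hab
    refine ext_inner_right ℝ fun w => ?_
    have := LinearMap.congr_fun hab (InnerProductSpace.toDual ℝ H w)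
    simpa [topDualPairing_apply, real_inner_comm] using this
  · obtain ⟨w, rfl⟩ := (InnerProductSpace.toDual ℝ H).surjective f
    have := h w
    simp only [real_inner_comm w] at this
    exact this

end WeakConvergence

/-! ### Weighted averages with a nonintegrable weight. -/

section ErgodicAverage

theorem _root_.ContinuousOn.intervalIntegrable_of_nonneg {E : Type*} [NormedAddCommGroup E] {f : ℝ → E}
    (hf : ContinuousOn f (Ici 0)) {a b : ℝ} (ha : 0 ≤ a) (hb : 0 ≤ b) :
    IntervalIntegrable f volume a b :=
  (hf.mono fun _ ht => (le_min ha hb).trans ht.1).intervalIntegrable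

theorem tendsto_integral_atTop_of_not_integrable {lam : ℝ → ℝ}
    (hlam_pos : ∀ t, 0 ≤ t → 0 < lam t) (hlam_cont : ContinuousOn lam (Ici 0))
    (hlam : ¬ IntegrableOn lam (Ici 0)) :
    Tendsto (fun t => ∫ s in (0 : ℝ)..t, lam s) atTop atTop := by
  have hmono : MonotoneOn (fun t => ∫ s in (0 : ℝ)..t, lam s) (Ici 0) := by
    intro a ha b hb hab
    have h1 := intervalIntegral.integral_add_adjacent_intervals
      (hlam_cont.intervalIntegrable_of_nonneg le_rfl ha)
      (hlam_cont.intervalIntegrable_of_nonneg ha hb)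
    have h2 : 0 ≤ ∫ s in a..b, lam s :=
      intervalIntegral.integral_nonneg hab fun s hs => (hlam_pos s (le_trans ha hs.1)).le
    change (∫ s in (0 : ℝ)..a, lam s) ≤ ∫ s in (0 : ℝ)..b, lam s
    linarith
  refine tendsto_atTop.2 fun K => ?_
  by_contra hK
  refine hlam ((integrableOn_Ici_iff_integrableOn_Ioi).2 ?_)
  refine integrableOn_Ioi_of_intervalIntegral_norm_bounded K 0 (b := fun t : ℝ => t) (l := atTop)
    (fun t => ?_) tendsto_id ?_
  · exact (hlam_cont.mono Icc_subset_Ici_self).integrableOn_Icc.mono_set Ioc_subset_Icc_self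
  · filter_upwards [eventually_ge_atTop 0] with t ht
    rw [intervalIntegral.integral_congr (g := lam) fun s hs => by
      rw [uIcc_of_le ht] at hs
      exact Real.norm_of_nonneg (hlam_pos s hs.1).le]
    by_contra! hlt
    refine hK ?_
    filter_upwards [eventually_ge_atTop t] with r hr
    exact hlt.le.trans (hmono ht (ht.trans hr) hr)

theorem integral_pos_of_pos {lam : ℝ → ℝ} (hlam_pos : ∀ t, 0 ≤ t → 0 < lam t)
    (hlam_cont : ContinuousOn lam (Ici 0)) {t : ℝ} (ht : 0 < t) :
    0 < ∫ s in (0 : ℝ)..t, lam s :=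
  intervalIntegral.intervalIntegral_pos_of_pos_on
    (hlam_cont.intervalIntegrable_of_nonneg le_rfl ht.le) (fun s hs => hlam_pos s hs.1.le) ht

variable {H : Type*} [NormedAddCommGroup H] [InnerProductSpace ℝ H]

theorem norm_ergodicAverage_le {lam : ℝ → ℝ} (hlam_pos : ∀ t, 0 ≤ t → 0 < lam t)
    (hlam_cont : ContinuousOn lam (Ici 0)) {x : ℝ → H} {R : ℝ}
    (hR : ∀ t, 0 ≤ t → ‖x t‖ ≤ R) {t : ℝ} (ht : 0 < t) : ‖ergodicAverage lam x t‖ ≤ R := by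
  have hpos := integral_pos_of_pos hlam_pos hlam_cont ht
  rw [ergodicAverage, norm_smul, norm_inv, Real.norm_of_nonneg hpos.le, inv_mul_le_iff₀ hpos,
    ← intervalIntegral.integral_mul_const]
  refine intervalIntegral.norm_integral_le_of_norm_le ht.le (ae_of_all _ fun s hs => ?_)
    ((hlam_cont.intervalIntegrable_of_nonneg le_rfl ht.le).mul_const R)
  rw [norm_smul, Real.norm_of_nonneg (hlam_pos s hs.1.le).le]
  exact mul_le_mul_of_nonneg_left (hR s hs.1.le) (hlam_pos s hs.1.le).le

theorem inner_ergodicAverage [CompleteSpace H] {lam : ℝ → ℝ} (hlam_cont : ContinuousOn lam (Ici 0))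
    {x : ℝ → H} (hx : ContinuousOn x (Ici 0)) (w : H) {t : ℝ} (ht : 0 ≤ t) :
    inner ℝ (ergodicAverage lam x t) w = ergodicAverage lam (fun s => inner ℝ (x s) w) t := by
  rw [ergodicAverage, ergodicAverage, real_inner_smul_left, real_inner_comm, smul_eq_mul]
  congr 1
  have := (innerSL ℝ w).intervalIntegral_comp_comm
    ((hlam_cont.fun_smul hx).intervalIntegrable_of_nonneg le_rfl ht)
  simp only [innerSL_apply_apply, real_inner_smul_right] at this
  rw [← this]
  simp only [smul_eq_mul, real_inner_comm w]

theorem ergodicAverage_sub {lam : ℝ → ℝ} (hlam_cont : ContinuousOn lam (Ici 0)) {f g : ℝ → ℝ}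
    (hf : ContinuousOn f (Ici 0)) (hg : ContinuousOn g (Ici 0)) {t : ℝ} (ht : 0 ≤ t) :
    ergodicAverage lam (fun s => f s - g s) t = ergodicAverage lam f t - ergodicAverage lam g t := by
  simp only [ergodicAverage, smul_eq_mul, mul_sub]
  rw [intervalIntegral.integral_sub
    ((hlam_cont.fun_mul hf).intervalIntegrable_of_nonneg le_rfl ht)
    ((hlam_cont.fun_mul hg).intervalIntegrable_of_nonneg le_rfl ht), mul_sub]

theorem ergodicAverage_const {lam : ℝ → ℝ} (hlam_pos : ∀ t, 0 ≤ t → 0 < lam t)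
    (hlam_cont : ContinuousOn lam (Ici 0)) (c : ℝ) {t : ℝ} (ht : 0 < t) :
    ergodicAverage lam (fun _ => c) t = c := by
  have hpos := integral_pos_of_pos hlam_pos hlam_cont ht
  simp only [ergodicAverage, smul_eq_mul]
  rw [intervalIntegral.integral_mul_const, inv_mul_cancel_left₀ hpos.ne']

/-- The weighted averages of a convergent function converge to the same limit. -/
theorem tendsto_ergodicAverage {lam : ℝ → ℝ} (hlam_pos : ∀ t, 0 ≤ t → 0 < lam t)
    (hlam_cont : ContinuousOn lam (Ici 0)) (hlam : ¬ IntegrableOn lam (Ici 0)) {f : ℝ → ℝ}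
    (hf : ContinuousOn f (Ici 0)) {c : ℝ} (hc : Tendsto f atTop (𝓝 c)) :
    Tendsto (ergodicAverage lam f) atTop (𝓝 c) := by
  have hΛ := tendsto_integral_atTop_of_not_integrable hlam_pos hlam_cont hlam
  rw [Metric.tendsto_atTop] at hc
  refine Metric.tendsto_nhds.2 fun ε hε => ?_
  obtain ⟨T₀, hT₀⟩ := hc (ε / 2) (by positivity)
  set T := max T₀ 0
  have hT : 0 ≤ T := le_max_right _ _
  -- The contribution of [0, T] is fixed; once ∫λ exceeds 2|K|/ε it costs less than ε/2 after
  -- division, and the tail costs at most ε/2.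
  set K := ∫ s in (0 : ℝ)..T, lam s * (f s - c)
  filter_upwards [eventually_gt_atTop T, hΛ.eventually_gt_atTop (2 * |K| / ε)] with t ht hKt
  have ht0 : 0 < t := hT.trans_lt ht
  have hpos := integral_pos_of_pos hlam_pos hlam_cont ht0
  have hfc : ContinuousOn (fun s => f s - c) (Ici 0) := hf.sub continuousOn_const
  have hii : ∀ {a b : ℝ}, 0 ≤ a → 0 ≤ b →
      IntervalIntegrable (fun s => lam s * (f s - c)) volume a b :=
    fun ha hb => (hlam_cont.fun_mul hfc).intervalIntegrable_of_nonneg ha hb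
  have htail : |∫ s in T..t, lam s * (f s - c)| ≤ (∫ s in (0 : ℝ)..t, lam s) * (ε / 2) := by
    have h1 : |∫ s in T..t, lam s * (f s - c)| ≤ ∫ s in T..t, lam s * (ε / 2) := by
      rw [← Real.norm_eq_abs]
      refine intervalIntegral.norm_integral_le_of_norm_le ht.le (ae_of_all _ fun s hs => ?_)
        ((hlam_cont.intervalIntegrable_of_nonneg hT ht0.le).mul_const _)
      have hs0 : 0 ≤ s := hT.trans hs.1.le
      rw [norm_mul, Real.norm_of_nonneg (hlam_pos s hs0).le]
      exact mul_le_mul_of_nonneg_left (hT₀ s ((le_max_left _ _).trans hs.1.le)).le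
        (hlam_pos s hs0).le
    have h2 : 0 ≤ ∫ s in (0 : ℝ)..T, lam s :=
      intervalIntegral.integral_nonneg hT fun s hs => (hlam_pos s hs.1).le
    have h3 := intervalIntegral.integral_add_adjacent_intervals
      (hlam_cont.intervalIntegrable_of_nonneg le_rfl hT)
      (hlam_cont.intervalIntegrable_of_nonneg hT ht0.le)
    rw [intervalIntegral.integral_mul_const] at h1
    refine h1.trans (mul_le_mul_of_nonneg_right ?_ (by positivity))
    linarith
  have hsplit := intervalIntegral.integral_add_adjacent_intervals (hii le_rfl hT) (hii hT ht0.le)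
  rw [Real.dist_eq, ← ergodicAverage_const hlam_pos hlam_cont c ht0,
    ← ergodicAverage_sub hlam_cont hf continuousOn_const ht0.le]
  simp only [ergodicAverage, smul_eq_mul]
  rw [abs_mul, abs_inv, abs_of_pos hpos, inv_mul_lt_iff₀ hpos, ← hsplit]
  refine (abs_add_le _ _).trans_lt ?_
  rw [div_lt_iff₀ hε] at hKt
  change |K| + _ < _
  linarith

end ErgodicAverage

/-! ### Absolutely continuous functions and Lyapunov inequalities. -/

section AbsoluteContinuity

theorem _root_.AbsolutelyContinuousOnInterval.norm {E : Type*} [SeminormedAddCommGroup E]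
    {f : ℝ → E} {a b : ℝ} (hf : AbsolutelyContinuousOnInterval f a b) :
    AbsolutelyContinuousOnInterval (fun t => ‖f t‖) a b :=
  squeeze_zero (fun _ => Finset.sum_nonneg fun _ _ => dist_nonneg)
    (fun _ => Finset.sum_le_sum fun _ _ => (dist_norm_norm_le _ _).trans_eq (dist_eq_norm _ _).symm) hf

/-- Polarization reduces the inner product to products of real absolutely continuous functions. -/
theorem _root_.AbsolutelyContinuousOnInterval.inner {H : Type*} [NormedAddCommGroup H]
    [InnerProductSpace ℝ H] {f g : ℝ → H} {a b : ℝ} (hf : AbsolutelyContinuousOnInterval f a b)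
    (hg : AbsolutelyContinuousOnInterval g a b) :
    AbsolutelyContinuousOnInterval (fun t => inner ℝ (f t) (g t)) a b := by
  have h1 := (hf.fun_add hg).norm
  have h2 := (hf.fun_sub hg).norm
  have h := ((h1.fun_mul h1).fun_sub (h2.fun_mul h2)).const_mul (1 / 4)
  convert h using 2 with t
  rw [norm_add_mul_self_real, norm_sub_mul_self_real]
  ring

theorem absolutelyContinuousOnInterval_const {E : Type*} [SeminormedAddCommGroup E] (c : E)
    (a b : ℝ) : AbsolutelyContinuousOnInterval (fun _ : ℝ => c) a b :=
  (LipschitzWith.const c).lipschitzOnWith.absolutelyContinuousOnInterval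

theorem timeDeriv_eq_deriv {E : Type*} [NormedAddCommGroup E] [NormedSpace ℝ E] (f : ℝ → E)
    {t : ℝ} (ht : 0 < t) : timeDeriv f t = deriv f t :=
  derivWithin_of_mem_nhds (Ici_mem_nhds ht)

variable {E : Type*} [NormedAddCommGroup E]

theorem LocallyAC.on_interval {f : ℝ → E} (hf : LocallyAC f) {a b : ℝ} (ha : 0 ≤ a) (hb : 0 ≤ b) :
    AbsolutelyContinuousOnInterval f a b := by
  refine (hf (max a b + 1) (by positivity)).mono ?_
  rw [uIcc_of_le (by positivity : (0 : ℝ) ≤ max a b + 1)]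
  exact Icc_subset_Icc (le_min ha hb) (by linarith)

theorem LocallyAC.continuousOn {f : ℝ → E} (hf : LocallyAC f) : ContinuousOn f (Ici 0) := by
  intro t ht
  have h0 : (0 : ℝ) ≤ t + 1 := by
    have : (0 : ℝ) ≤ t := ht
    linarith
  have h := (hf.on_interval le_rfl h0).continuousOn
  rw [uIcc_of_le h0] at h
  refine (h t ⟨ht, by linarith⟩).mono_of_mem_nhdsWithin ?_
  rw [← Ici_inter_Iic]
  exact inter_mem self_mem_nhdsWithin (mem_nhdsWithin_of_mem_nhds (Iic_mem_nhds (by linarith)))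

theorem LocallyAC.norm_sq {f : ℝ → E} (hf : LocallyAC f) : LocallyAC fun t => ‖f t‖ ^ 2 :=
  fun b hb => by
    simp only [sq]
    exact (hf b hb).norm.fun_mul (hf b hb).norm

theorem LocallyAC.sub_const {f : ℝ → E} (hf : LocallyAC f) (z : E) : LocallyAC fun t => f t - z :=
  fun b hb => (hf b hb).fun_sub (absolutelyContinuousOnInterval_const z 0 b)

theorem LocallyAC.integral_deriv {f : ℝ → ℝ} (hf : LocallyAC f) {a b : ℝ} (ha : 0 ≤ a)
    (hb : 0 ≤ b) : ∫ t in a..b, deriv f t = f b - f a :=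
  (hf.on_interval ha hb).integral_deriv_eq_sub

theorem LocallyAC.intervalIntegrable_deriv {f : ℝ → ℝ} (hf : LocallyAC f) {a b : ℝ} (ha : 0 ≤ a)
    (hb : 0 ≤ b) : IntervalIntegrable (deriv f) volume a b :=
  (hf.on_interval ha hb).intervalIntegrable_deriv

theorem LocallyAC.sub_le_integral {f g : ℝ → ℝ} (hf : LocallyAC f) {T : ℝ} (hT : 0 ≤ T)
    (hg : ∀ᵐ t ∂volume.restrict (Ioi T), deriv f t ≤ g t) {a b : ℝ} (ha : T ≤ a) (hab : a ≤ b)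
    (hgi : IntervalIntegrable g volume a b) : f b - f a ≤ ∫ t in a..b, g t := by
  have ha0 : 0 ≤ a := hT.trans ha
  rw [← hf.integral_deriv ha0 (ha0.trans hab)]
  refine intervalIntegral.integral_mono_ae_restrict hab
    (hf.intervalIntegrable_deriv ha0 (ha0.trans hab)) hgi ?_
  rw [EventuallyLE, ← restrict_Ioc_eq_restrict_Icc]
  exact ae_restrict_of_ae_restrict_of_subset (fun t ht => ha.trans_lt ht.1) hg

theorem exists_tendsto_of_antitoneOn {F : ℝ → ℝ} {T K : ℝ} (hF : AntitoneOn F (Ici T))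
    (hK : ∀ t, T ≤ t → K ≤ F t) : ∃ l, Tendsto F atTop (𝓝 l) := by
  have hanti : Antitone fun t => F (max T t) := fun a b hab =>
    hF (le_max_left T a) (le_max_left T b) (max_le_max_left _ hab)
  refine ⟨_, (tendsto_atTop_ciInf hanti ⟨K, ?_⟩).congr' ?_⟩
  · rintro _ ⟨t, rfl⟩
    exact hK _ (le_max_left _ _)
  · filter_upwards [eventually_ge_atTop T] with t ht
    rw [max_eq_right ht]

theorem intervalIntegrable_of_integrableOn_Ioi {G : ℝ → E} {T : ℝ} (hG : IntegrableOn G (Ioi T))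
    {a b : ℝ} (ha : T ≤ a) (hab : a ≤ b) : IntervalIntegrable G volume a b :=
  (intervalIntegrable_iff_integrableOn_Ioc_of_le hab).2
    (hG.mono_set fun _ ht => ha.trans_lt ht.1)

/-- A locally absolutely continuous function that is bounded below and whose derivative is bounded
above by an integrable function converges. -/
theorem LocallyAC.exists_tendsto_of_deriv_le {f G : ℝ → ℝ} (hf : LocallyAC f) {T K : ℝ}
    (hT : 0 ≤ T) (hK : ∀ t, T ≤ t → K ≤ f t) (hG : IntegrableOn G (Ioi T))
    (hle : ∀ᵐ t ∂volume.restrict (Ioi T), deriv f t ≤ G t) : ∃ l, Tendsto f atTop (𝓝 l) := by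
  have hlim := intervalIntegral_tendsto_integral_Ioi T hG tendsto_id
  -- Subtracting the primitive of G leaves a nonincreasing function, bounded below because G is
  -- integrable.
  have hanti : AntitoneOn (fun t => f t - ∫ s in T..t, G s) (Ici T) := by
    intro a ha b hb hab
    have h1 := hf.sub_le_integral hT hle ha hab (intervalIntegrable_of_integrableOn_Ioi hG ha hab)
    have h2 := intervalIntegral.integral_add_adjacent_intervals
      (intervalIntegrable_of_integrableOn_Ioi hG le_rfl ha)
      (intervalIntegrable_of_integrableOn_Ioi hG ha hab)
    change f b - (∫ s in T..b, G s) ≤ f a - ∫ s in T..a, G s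
    linarith
  obtain ⟨l, hl⟩ := exists_tendsto_of_antitoneOn (K := K - ∫ s in Ioi T, ‖G s‖) hanti
    fun t ht => by
      have h1 := intervalIntegral.norm_integral_le_integral_norm (f := G) (μ := volume) ht
      have h2 : ∫ s in T..t, ‖G s‖ ≤ ∫ s in Ioi T, ‖G s‖ := by
        rw [intervalIntegral.integral_of_le ht]
        exact setIntegral_mono_set hG.norm (ae_of_all _ fun _ => norm_nonneg _)
          (ae_of_all _ fun s hs => hs.1)
      have h3 := le_abs_self (∫ s in T..t, G s)
      rw [Real.norm_eq_abs] at h1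
      have := hK t ht
      linarith
  refine ⟨l + ∫ s in Ioi T, G s, (hl.add hlim).congr fun t => ?_⟩
  simp

/-- The dissipation in a Lyapunov inequality `f' + g ≤ G` is integrable. -/
theorem LocallyAC.integrableOn_of_le_sub_deriv {f g G : ℝ → ℝ} (hf : LocallyAC f) {T K : ℝ}
    (hT : 0 ≤ T) (hK : ∀ t, T ≤ t → K ≤ f t) (hG : IntegrableOn G (Ioi T))
    (hg : AEStronglyMeasurable g (volume.restrict (Ioi T)))
    (hg0 : ∀ᵐ t ∂volume.restrict (Ioi T), 0 ≤ g t)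
    (hle : ∀ᵐ t ∂volume.restrict (Ioi T), g t + deriv f t ≤ G t) : IntegrableOn g (Ioi T) := by
  have hae : ∀ {t}, T ≤ t → ∀ᵐ s ∂volume.restrict (Ioc T t), ‖g s‖ ≤ G s - deriv f s := by
    intro t _
    have h : ∀ᵐ s ∂volume.restrict (Ioi T), ‖g s‖ ≤ G s - deriv f s := by
      filter_upwards [hg0, hle] with s h1 h2
      rw [Real.norm_of_nonneg h1]
      linarith
    exact ae_restrict_of_ae_restrict_of_subset (fun s hs => hs.1) h
  have hint : ∀ {t}, T ≤ t → IntervalIntegrable (fun s => G s - deriv f s) volume T t :=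
    fun ht => (intervalIntegrable_of_integrableOn_Ioi hG le_rfl ht).sub
      (hf.intervalIntegrable_deriv hT (hT.trans ht))
  -- Local integrability of g is not assumed; it follows from 0 ≤ g ≤ G − f'.
  have hgint : ∀ {t}, T ≤ t → IntegrableOn g (Ioc T t) := fun ht =>
    Integrable.mono' ((intervalIntegrable_iff_integrableOn_Ioc_of_le ht).1 (hint ht))
      (hg.mono_set fun s hs => hs.1) (hae ht)
  obtain ⟨C, hC⟩ : ∃ C, ∀ t, T ≤ t → ∫ s in T..t, G s ≤ C := by
    refine ⟨∫ s in Ioi T, ‖G s‖, fun t ht => ?_⟩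
    rw [intervalIntegral.integral_of_le ht]
    refine (Real.le_norm_self _).trans ((norm_integral_le_integral_norm _).trans ?_)
    exact setIntegral_mono_set hG.norm (ae_of_all _ fun _ => norm_nonneg _)
      (ae_of_all _ fun s hs => hs.1)
  refine integrableOn_Ioi_of_intervalIntegral_norm_bounded (C + f T - K) T
    (b := fun t : ℝ => max T t) (l := atTop) (fun t => hgint (le_max_left _ _))
    (tendsto_atTop_mono (fun t => le_max_right T t) tendsto_id) (Eventually.of_forall fun t => ?_)
  have ht : T ≤ max T t := le_max_left _ _
  have h1 : ∫ s in T..max T t, ‖g s‖ ≤ ∫ s in T..max T t, (G s - deriv f s) := by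
    refine intervalIntegral.integral_mono_ae_restrict ht
      ((intervalIntegrable_iff_integrableOn_Ioc_of_le ht).2 (hgint ht).norm) (hint ht) ?_
    rw [EventuallyLE, ← restrict_Ioc_eq_restrict_Icc]
    exact hae ht
  rw [intervalIntegral.integral_sub (intervalIntegrable_of_integrableOn_Ioi hG le_rfl ht)
    (hf.intervalIntegrable_deriv hT (hT.trans ht)), hf.integral_deriv hT (hT.trans ht)] at h1
  have := hC _ ht
  have := hK _ ht
  linarith

theorem eq_zero_of_integrableOn_of_tendsto {f : ℝ → ℝ} {T l : ℝ} (hf : IntegrableOn f (Ioi T))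
    (hl : Tendsto f atTop (𝓝 l)) : l = 0 := by
  refine IntegrableAtFilter.eq_zero_of_tendsto ⟨Ioi T, Ioi_mem_atTop T, hf⟩ (fun s hs => ?_) hl
  obtain ⟨b, hb⟩ := mem_atTop_sets.1 hs
  rw [← top_le_iff, ← Real.volume_Ici (a := b)]
  exact measure_mono hb

theorem LocallyAC.tendsto_zero_of_integrableOn {f g : ℝ → ℝ} (hf : LocallyAC f) {T : ℝ}
    (hT : 0 ≤ T) (hfi : IntegrableOn f (Ioi T)) (hg : IntegrableOn g (Ioi T))
    (hle : ∀ᵐ t ∂volume.restrict (Ioi T), deriv f t ≤ g t) (hf0 : ∀ t, T ≤ t → 0 ≤ f t) :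
    Tendsto f atTop (𝓝 0) := by
  obtain ⟨l, hl⟩ := hf.exists_tendsto_of_deriv_le hT hf0 hg hle
  rwa [eq_zero_of_integrableOn_of_tendsto hfi hl] at hl

theorem LocallyAC.antitoneOn {f : ℝ → ℝ} (hf : LocallyAC f)
    (h : ∀ᵐ t ∂volume.restrict (Ici (0 : ℝ)), timeDeriv f t ≤ 0) : AntitoneOn f (Ici 0) := by
  intro a ha b _ hab
  have h' : ∀ᵐ t ∂volume.restrict (Ioi (0 : ℝ)), deriv f t ≤ 0 := by
    rw [← restrict_Ioi_eq_restrict_Ici] at h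
    filter_upwards [h, ae_restrict_mem measurableSet_Ioi] with t h1 h2
    rwa [← timeDeriv_eq_deriv f h2]
  have := hf.sub_le_integral le_rfl h' ha hab intervalIntegrable_const
  simp only [intervalIntegral.integral_zero] at this
  linarith

/-- A set of full measure is dense, so continuity carries the inequality to every time, including 0.
-/
theorem le_of_ae_le {f : ℝ → ℝ} (hf : ContinuousOn f (Ici 0)) {c : ℝ}
    (h : ∀ᵐ t ∂volume.restrict (Ici (0 : ℝ)), c ≤ f t) {t : ℝ} (ht : 0 ≤ t) : c ≤ f t := by
  rw [← restrict_Ioi_eq_restrict_Ici, ae_restrict_iff' measurableSet_Ioi] at h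
  have hclos : t ∈ closure (Ioi 0 ∩ {s | s ∈ Ioi (0 : ℝ) → c ≤ f s}) := by
    refine closure_minimal ((Measure.dense_of_ae h).open_subset_closure_inter isOpen_Ioi)
      isClosed_closure ?_
    rwa [closure_Ioi]
  have hsub : (Ioi 0 ∩ {s | s ∈ Ioi (0 : ℝ) → c ≤ f s}) ⊆ Ici 0 :=
    inter_subset_left.trans Ioi_subset_Ici_self
  have := mem_closure_iff_nhdsWithin_neBot.1 hclos
  refine ge_of_tendsto ((hf t ht).mono hsub) ?_
  filter_upwards [self_mem_nhdsWithin] with s hs using hs.2 hs.1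

theorem integrableOn_Ici_of_Ioi {f : ℝ → E} {T : ℝ} (hT : 0 ≤ T)
    (hf : ContinuousOn f (Ici 0)) (h : IntegrableOn f (Ioi T)) : IntegrableOn f (Ici 0) := by
  rw [← Icc_union_Ioi_eq_Ici hT]
  exact (hf.mono Icc_subset_Ici_self).integrableOn_Icc.union h

end AbsoluteContinuity

/-! ### The pointwise estimate and the energy. -/

section Energy

variable {H : Type*} [NormedAddCommGroup H] [InnerProductSpace ℝ H]

theorem neg_young_le_inner (y a : H) {c : ℝ} (hc : 0 < c) :
    -(c * ‖y‖ ^ 2 + (4 * c)⁻¹ * ‖a‖ ^ 2) ≤ inner ℝ y a := by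
  have h1 : 0 ≤ (4 * c)⁻¹ * ‖(2 * c) • y + a‖ ^ 2 := by positivity
  rw [norm_add_sq_real, norm_smul, real_inner_smul_left, Real.norm_of_nonneg (by positivity)] at h1
  have h2 : (4 * c)⁻¹ * ((2 * c * ‖y‖) ^ 2 + 2 * (2 * c * inner ℝ y a) + ‖a‖ ^ 2) =
      c * ‖y‖ ^ 2 + inner ℝ y a + (4 * c)⁻¹ * ‖a‖ ^ 2 := by
    field_simp
    ring
  linarith

/-- The pointwise estimate that follows from the monotonicity of `A` and the cocoercivity of `D`
and `B`, for `r ∈ A (y + X)` and `v ∈ A z`. -/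
theorem penalized_inclusion_estimate {X y z v p w r DX DZ BX : H} {l b L_D L_B η : ℝ}
    (hl : 0 < l) (hb : 0 < b) (hL_D : 0 < L_D) (hL_B : 0 < L_B)
    (hlD : l * L_D ≤ 1 / 8) (hlB : l * b * L_B ≤ 1)
    (hr : l • r = -y - l • DX - (l * b) • BX)
    (hmono : η * ‖y + X - z‖ ^ 2 ≤ inner ℝ (y + X - z) (r - v))
    (hD : L_D⁻¹ * ‖DX - DZ‖ ^ 2 ≤ inner ℝ (X - z) (DX - DZ))
    (hB : L_B⁻¹ * ‖BX‖ ^ 2 ≤ inner ℝ (X - z) BX) (hw : w = v + DZ + p) :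
    9 / 16 * ‖y‖ ^ 2 + inner ℝ (X - z) y + 1 / 8 * (l * b * inner ℝ (X - z) BX) +
        l * (η * ‖y + X - z‖ ^ 2) ≤
      1 / 8 * (8 * l * inner ℝ (X - z) p - l * b * inner ℝ (X - z) BX) +
        8 * (l ^ 2 * ‖w - p‖ ^ 2) + l * inner ℝ (z - X) w := by
  have hbase := mul_le_mul_of_nonneg_left hmono hl.le
  have hexp : l * inner ℝ (y + X - z) (r - v) =
      -(‖y‖ ^ 2 + inner ℝ (X - z) y + l * inner ℝ (X - z) (DX - DZ) +
        l * b * inner ℝ (X - z) BX + l * inner ℝ (X - z) w - l * inner ℝ (X - z) p +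
        l * inner ℝ y (DX - DZ) + l * inner ℝ y (w - p) + l * b * inner ℝ y BX) := by
    rw [← real_inner_smul_right, smul_sub, hr, show v = w - p - DZ by rw [hw]; abel, add_sub_assoc]
    simp only [inner_add_left, inner_sub_left, inner_sub_right, inner_neg_right, smul_sub,
      real_inner_smul_right, real_inner_self_eq_norm_sq]
    ring
  -- The weights 3/8, 1/32, 1/32 use up 7/16 of ‖y‖² and leave 9/16. The B term loses 2/3 of lb⟨X −
  -- z, BX⟩, and the remaining third covers the two shares of 1/8; the D term is absorbed exactly
  -- when lL_D ≤ 1/8.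
  have h1 := neg_young_le_inner y ((l * b) • BX) (c := 3 / 8) (by norm_num)
  have h2 := neg_young_le_inner y (l • (DX - DZ)) (c := 1 / 32) (by norm_num)
  have h3 := neg_young_le_inner y (l • (w - p)) (c := 1 / 32) (by norm_num)
  rw [real_inner_smul_right, norm_smul, Real.norm_of_nonneg (by positivity), mul_pow] at h1 h2 h3
  have h4 : (l * b) ^ 2 * ‖BX‖ ^ 2 ≤ l * b * inner ℝ (X - z) BX := by
    have h5 : (l * b) ^ 2 ≤ l * b * L_B⁻¹ := by
      rw [sq]
      refine mul_le_mul_of_nonneg_left ?_ (by positivity)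
      rwa [← one_div, le_div_iff₀ hL_B]
    have := mul_le_mul_of_nonneg_right h5 (sq_nonneg ‖BX‖)
    have := mul_le_mul_of_nonneg_left hB (by positivity : 0 ≤ l * b)
    linarith
  have h6 : 8 * (l ^ 2 * ‖DX - DZ‖ ^ 2) ≤ l * inner ℝ (X - z) (DX - DZ) := by
    have h7 : 8 * l ^ 2 ≤ l * L_D⁻¹ := by
      rw [sq, ← mul_assoc, mul_comm (8 * l) l, ← one_div]
      refine mul_le_mul_of_nonneg_left ?_ hl.le
      rw [le_div_iff₀ hL_D]
      linarith
    have := mul_le_mul_of_nonneg_right h7 (sq_nonneg ‖DX - DZ‖)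
    have := mul_le_mul_of_nonneg_left hD hl.le
    linarith
  have h8 : 0 ≤ l * b * inner ℝ (X - z) BX := by
    refine mul_nonneg (by positivity) (le_trans (by positivity) hB)
  have h9 : inner ℝ (z - X) w = -inner ℝ (X - z) w := by
    rw [← inner_neg_left, neg_sub]
  rw [h9]
  norm_num at h1 h2 h3
  linarith

/-- Nonexpansiveness of the resolvent. No smallness of the parameters is needed, so this controls
the acceleration on the initial interval too. -/
theorem norm_le_of_penalized_inclusion {X y z v r DX BX : H} {l b : ℝ} (hl : 0 < l) (hb : 0 < b)
    (hr : l • r = -y - l • DX - (l * b) • BX) (hmono : 0 ≤ inner ℝ (y + X - z) (r - v)) :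
    ‖y‖ ≤ 2 * ‖X - z‖ + (l * ‖DX‖ + l * b * ‖BX‖ + l * ‖v‖) := by
  have hbase : 0 ≤ inner ℝ (y + X - z) (l • r - l • v) := by
    rw [← smul_sub, real_inner_smul_right]
    exact mul_nonneg hl.le hmono
  set q := y + X - z with hq
  set c := (X - z) - (l • DX + (l * b) • BX + l • v) with hc
  have heq : l • r - l • v = c - q := by
    rw [hr, hc, hq]
    abel
  rw [heq, inner_sub_right, real_inner_self_eq_norm_sq] at hbase
  have hqc : ‖q‖ ≤ ‖c‖ := by
    have := real_inner_le_norm q c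
    rcases (norm_nonneg q).eq_or_lt with h0 | h0
    · rw [← h0]
      positivity
    · refine le_of_mul_le_mul_left ?_ h0
      nlinarith
  have hy : ‖y‖ ≤ ‖q‖ + ‖X - z‖ := by
    rw [show y = q - (X - z) by rw [hq]; abel]
    exact norm_sub_le _ _
  have hcn : ‖c‖ ≤ ‖X - z‖ + (l * ‖DX‖ + l * b * ‖BX‖ + l * ‖v‖) := by
    refine (norm_sub_le _ _).trans (add_le_add le_rfl ?_)
    refine norm_add₃_le.trans_eq ?_
    rw [norm_smul, norm_smul, norm_smul, Real.norm_of_nonneg hl.le,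
      Real.norm_of_nonneg (by positivity)]
  linarith

/-- The Lyapunov function `d/dt (½ ‖x - z‖²) + ½ γ ‖x - z‖² + (9/16) γ ‖x'‖²`. -/
noncomputable def energy (γ : ℝ → ℝ) (x : ℝ → H) (z : H) (t : ℝ) : ℝ :=
  inner ℝ (x t - z) (timeDeriv x t) + γ t * ((1 / 2) * ‖x t - z‖ ^ 2) +
    9 / 16 * (γ t * ‖timeDeriv x t‖ ^ 2)

theorem locallyAC_energy {γ : ℝ → ℝ} (hγ : LocallyAC γ) {x : ℝ → H} (hx : LocallyAC x)
    (hx' : LocallyAC (timeDeriv x)) (z : H) : LocallyAC (energy γ x z) := fun b hb =>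
  (((hx.sub_const z b hb).inner (hx' b hb)).fun_add
    ((hγ b hb).fun_mul (((hx.sub_const z).norm_sq b hb).const_mul (1 / 2)))).fun_add
    (((hγ b hb).fun_mul (hx'.norm_sq b hb)).const_mul (9 / 16))

theorem sqrt_two_gt : (1.4 : ℝ) < √2 := Real.lt_sqrt_of_sq_lt (by norm_num)

/-- With γ ≥ 1.4 the energy is at least 0.7a² − ab + 0.7875b², where a = ‖x − z‖ and b = ‖x'‖, and
ab ≤ (a² + b²)/2. -/
theorem le_energy {γ : ℝ → ℝ} {x : ℝ → H} (z : H) {t : ℝ} (hγ : √2 ≤ γ t) :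
    1 / 10 * (‖x t - z‖ ^ 2 + ‖timeDeriv x t‖ ^ 2) ≤ energy γ x z t := by
  have h1 := neg_le_of_abs_le (abs_real_inner_le_norm (x t - z) (timeDeriv x t))
  have h2 : (1.4 : ℝ) ≤ γ t := sqrt_two_gt.le.trans hγ
  have h3 := mul_le_mul_of_nonneg_right h2 (sq_nonneg ‖x t - z‖)
  have h4 := mul_le_mul_of_nonneg_right h2 (sq_nonneg ‖timeDeriv x t‖)
  have h5 := sq_nonneg (‖x t - z‖ - ‖timeDeriv x t‖)
  rw [energy]
  nlinarith

theorem energy_nonneg {γ : ℝ → ℝ} {x : ℝ → H} (z : H) {t : ℝ} (hγ : √2 ≤ γ t) :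
    0 ≤ energy γ x z t :=
  le_trans (by positivity) (le_energy z hγ)

/-- The mixed terms ⟨x', x''⟩ cancel. Since γ² ≥ 2, (9/16)γ²‖x'‖² pays for the ‖x'‖² created by
differentiating ⟨x − z, x'⟩ and leaves (1/8)‖x'‖²; any coefficient above 1/2 would leave something.
The terms in γ' have the good sign. -/
theorem deriv_energy_le {γ : ℝ → ℝ} {x : ℝ → H} {z x₂ : H} {t : ℝ}
    (hγ : √2 ≤ γ t) (hγd : DifferentiableAt ℝ γ t) (hγ' : deriv γ t ≤ 0)
    (hx : HasDerivAt x (timeDeriv x t) t) (hx' : HasDerivAt (timeDeriv x) x₂ t) :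
    deriv (energy γ x z) t + 9 / 16 * ‖x₂‖ ^ 2 + 1 / 8 * ‖timeDeriv x t‖ ^ 2 ≤
      9 / 16 * ‖x₂ + γ t • timeDeriv x t‖ ^ 2 + inner ℝ (x t - z) (x₂ + γ t • timeDeriv x t) := by
  have h1 := hx.sub_const z
  have hd := ((h1.inner ℝ hx').add (hγd.hasDerivAt.mul (h1.norm_sq.const_mul (1 / 2)))).add
    ((hγd.hasDerivAt.mul hx'.norm_sq).const_mul (9 / 16))
  have hd' : deriv (energy γ x z) t = _ := HasDerivAt.deriv hd
  rw [hd', norm_add_sq_real, norm_smul, real_inner_smul_right, inner_add_right,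
    real_inner_smul_right, real_inner_self_eq_norm_sq, mul_pow, Real.norm_eq_abs, sq_abs,
    real_inner_comm (timeDeriv x t) x₂]
  have h2 : (2 : ℝ) ≤ γ t ^ 2 := by
    rw [← Real.sq_sqrt (by norm_num : (0 : ℝ) ≤ 2)]
    exact pow_le_pow_left₀ (Real.sqrt_nonneg _) hγ 2
  have h3 := mul_le_mul_of_nonneg_right h2 (sq_nonneg ‖timeDeriv x t‖)
  have h4 := mul_nonneg (neg_nonneg.2 hγ') (sq_nonneg ‖x t - z‖)
  have h5 := mul_nonneg (neg_nonneg.2 hγ') (sq_nonneg ‖timeDeriv x t‖)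
  linarith

end Energy

/-! ### The inclusion along the trajectory and the Fitzpatrick forcing. -/

section Trajectory

variable {H : Type*} [NormedAddCommGroup H] [InnerProductSpace ℝ H]

theorem IsStrongGlobalSolution.ae_inclusion {A : H → Set H} {D B : H → H} {γ lam β : ℝ → ℝ}
    {u₀ v₀ : H} {x : ℝ → H} (hx : IsStrongGlobalSolution A D B γ lam β u₀ v₀ x) :
    ∀ᵐ t ∂volume.restrict (Ioi (0 : ℝ)), HasDerivAt x (timeDeriv x t) t ∧
      HasDerivAt (timeDeriv x) (timeDeriv (timeDeriv x) t) t ∧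
      ∃ r ∈ A (timeDeriv (timeDeriv x) t + γ t • timeDeriv x t + x t),
        lam t • r = -(timeDeriv (timeDeriv x) t + γ t • timeDeriv x t) - lam t • D (x t) -
          (lam t * β t) • B (x t) := by
  have heq := hx.equation
  rw [← restrict_Ioi_eq_restrict_Ici] at heq
  filter_upwards [heq, ae_restrict_mem measurableSet_Ioi] with t ht ht0
  have hnhds : Ici (0 : ℝ) ∈ 𝓝 t := Ici_mem_nhds ht0
  obtain ⟨hdiff, hmem⟩ := ht
  refine ⟨((hx.differentiable t (mem_Ioi.1 ht0).le).hasDerivWithinAt).hasDerivAt hnhds,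
    hdiff.hasDerivWithinAt.hasDerivAt hnhds, ?_⟩
  obtain ⟨a, ha, b, hb, hab⟩ := hmem
  obtain ⟨r, hr, rfl⟩ := hb
  rw [mem_singleton_iff] at ha
  refine ⟨r, hr, ?_⟩
  change a + lam t • r = _ at hab
  rw [← sub_eq_iff_eq_add'.2 hab.symm, ha]
  abel

/-- The integrable right-hand side of the energy inequality. -/
noncomputable def forcing (B : H → H) (lam β : ℝ → ℝ) (x : ℝ → H) (z p w : H) (t : ℝ) : ℝ :=
  1 / 8 * max (8 * lam t * inner ℝ (x t - z) p - lam t * β t * inner ℝ (x t - z) (B (x t))) 0 +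
    8 * (lam t ^ 2 * ‖w - p‖ ^ 2)

/-- Take u = z and y = X in the suprema; as q is a nonnegative multiple of a normal vector at z,
σ_C(q) is at most ⟨z, q⟩. -/
theorem le_fitzGap {B : H → H} {z p : H} (hp : p ∈ normalCone (zer (single B)) z) {q : H} {c : ℝ}
    (hc : 0 ≤ c) (hq : q = c • p) (X : H) :
    ((inner ℝ (X - z) q - inner ℝ (X - z) (B X) : ℝ) : EReal) ≤ fitzGap B q := by
  have hsupp : supportFun (zer (single B)) q ≤ ((inner ℝ z q : ℝ) : EReal) := by
    refine iSup₂_le fun y hy => EReal.coe_le_coe_iff.2 ?_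
    have := mul_nonpos_of_nonneg_of_nonpos hc (hp.2 y hy)
    rw [← real_inner_smul_right, ← hq, inner_sub_left] at this
    linarith
  have hfitz : ((inner ℝ z (B X) + inner ℝ X q - inner ℝ X (B X) : ℝ) : EReal) ≤
      ⨆ u ∈ zer (single B), fitzpatrick (single B) u q :=
    le_iSup₂_of_le z hp.1 (le_iSup_of_le X (le_iSup₂_of_le (B X) rfl le_rfl))
  have h := EReal.sub_le_sub hfitz hsupp
  refine le_trans (le_of_eq ?_) h
  rw [← EReal.coe_sub, inner_sub_left, inner_sub_left]
  congr 1
  ring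

theorem integrableOn_forcing {B : H → H} {lam β : ℝ → ℝ}
    (hlam_pos : ∀ t, 0 ≤ t → 0 < lam t) (hβ_pos : ∀ t, 0 ≤ t → 0 < β t)
    (hlam_cont : ContinuousOn lam (Ici 0)) (hβ_cont : ContinuousOn β (Ici 0))
    (hlam_L2 : MemLp lam 2 (volume.restrict (Ici (0 : ℝ)))) (hfitz : FitzCondition B lam β)
    (hB : Continuous B) {x : ℝ → H} (hx : ContinuousOn x (Ici 0)) {z p : H}
    (hp : p ∈ normalCone (zer (single B)) z) (w : H) :
    IntegrableOn (forcing B lam β x z p w) (Ici 0) := by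
  set q : ℝ → ℝ := fun t =>
    8 * lam t * inner ℝ (x t - z) p - lam t * β t * inner ℝ (x t - z) (B (x t)) with hq
  have hqc : ContinuousOn q (Ici 0) :=
    ((continuousOn_const.mul hlam_cont).mul
      ((hx.sub continuousOn_const).inner continuousOn_const)).sub
      ((hlam_cont.mul hβ_cont).mul
        ((hx.sub continuousOn_const).inner (hB.comp_continuousOn hx)))
  -- Only 1/8 of the penalty is available to compensate λ⟨x − z, p⟩, so the gap is needed at 8p,
  -- still a normal vector.
  have hp8 : (8 : ℝ) • p ∈ ran (normalCone (zer (single B))) := by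
    refine ⟨z, hp.1, fun y hy => ?_⟩
    rw [real_inner_smul_right]
    have := hp.2 y hy
    linarith
  have hlint : ∫⁻ t in Ici (0 : ℝ), ENNReal.ofReal (q t) < ⊤ := by
    refine lt_of_le_of_lt (setLIntegral_mono' measurableSet_Ici fun t ht => ?_) (hfitz _ hp8)
    have hβ := hβ_pos t ht
    have hlam := hlam_pos t ht
    have h := EReal.toENNReal_le_toENNReal (le_fitzGap hp (q := (β t)⁻¹ • (8 : ℝ) • p)
      (c := (β t)⁻¹ * 8) (by positivity) (smul_smul _ _ _) (x t))
    have hqt : q t = lam t * β t * (inner ℝ (x t - z) ((β t)⁻¹ • (8 : ℝ) • p) -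
        inner ℝ (x t - z) (B (x t))) := by
      rw [real_inner_smul_right, real_inner_smul_right, hq]
      field_simp
    rw [hqt, ENNReal.ofReal_mul (by positivity)]
    gcongr
    rwa [EReal.toENNReal_of_ne_top (EReal.coe_ne_top _), EReal.toReal_coe] at h
  have hqi : IntegrableOn (fun t => max (q t) 0) (Ici 0) := by
    refine ⟨((hqc.sup continuousOn_const).aestronglyMeasurable measurableSet_Ici), ?_⟩
    rw [hasFiniteIntegral_iff_ofReal (f := fun t => max (q t) 0)
      (ae_of_all _ fun t => le_max_right (q t) 0)]
    simpa using hlint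
  refine (hqi.const_mul (1 / 8)).add (Integrable.const_mul ?_ 8)
  exact (hlam_L2.integrable_sq).mul_const _

end Trajectory

/-! ### Dissipation, ergodic bounds and strong convergence. -/

section Asymptotics

variable {H : Type*} [NormedAddCommGroup H] [InnerProductSpace ℝ H]

theorem aestronglyMeasurable_accel [CompleteSpace H] (x : ℝ → H) :
    AEStronglyMeasurable (timeDeriv (timeDeriv x)) (volume.restrict (Ici (0 : ℝ))) := by
  rw [← restrict_Ioi_eq_restrict_Ici]
  refine (aestronglyMeasurable_deriv (timeDeriv x) _).congr ?_
  filter_upwards [ae_restrict_mem measurableSet_Ioi] with t ht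
  exact (timeDeriv_eq_deriv _ ht).symm

/-- Trajectories of the penalized second-order system whose parameters satisfy, from time `T` on,
the smallness conditions of the energy inequality. -/
structure PenalizedFlow (A : H → Set H) (D B : H → H) (L_D L_B : ℝ) (γ lam β : ℝ → ℝ)
    (x : ℝ → H) (T : ℝ) : Prop where
  L_D_pos : 0 < L_D
  L_B_pos : 0 < L_B
  cocoercive_D : Cocoercive L_D⁻¹ D
  cocoercive_B : Cocoercive L_B⁻¹ B
  lam_pos : ∀ t, 0 ≤ t → 0 < lam t
  β_pos : ∀ t, 0 ≤ t → 0 < β t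
  lam_cont : ContinuousOn lam (Ici 0)
  β_cont : ContinuousOn β (Ici 0)
  lam_L2 : MemLp lam 2 (volume.restrict (Ici (0 : ℝ)))
  fitz : FitzCondition B lam β
  γ_locallyAC : LocallyAC γ
  sqrt_two_le : ∀ t, 0 ≤ t → √2 ≤ γ t
  γ_deriv : ∀ᵐ t ∂volume.restrict (Ici (0 : ℝ)), timeDeriv γ t ≤ 0
  locallyAC : LocallyAC x
  locallyAC_deriv : LocallyAC (timeDeriv x)
  inclusion : ∀ᵐ t ∂volume.restrict (Ioi (0 : ℝ)), HasDerivAt x (timeDeriv x t) t ∧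
    HasDerivAt (timeDeriv x) (timeDeriv (timeDeriv x) t) t ∧
    ∃ r ∈ A (timeDeriv (timeDeriv x) t + γ t • timeDeriv x t + x t),
      lam t • r = -(timeDeriv (timeDeriv x) t + γ t • timeDeriv x t) - lam t • D (x t) -
        (lam t * β t) • B (x t)
  T_nonneg : 0 ≤ T
  step_D : ∀ t, T ≤ t → lam t * L_D ≤ 1 / 8
  step_B : ∀ t, T ≤ t → lam t * β t * L_B ≤ 1

namespace PenalizedFlow

variable {A : H → Set H} {D B : H → H} {L_D L_B : ℝ} {γ lam β : ℝ → ℝ} {x : ℝ → H} {T : ℝ}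
  {z v p w : H} {η : ℝ}

theorem ae_Ioi_T {P : ℝ → Prop} (h : PenalizedFlow A D B L_D L_B γ lam β x T)
    (hP : ∀ᵐ t ∂volume.restrict (Ioi (0 : ℝ)), P t) : ∀ᵐ t ∂volume.restrict (Ioi T), P t :=
  ae_restrict_of_ae_restrict_of_subset (Ioi_subset_Ioi h.T_nonneg) hP

theorem continuousOn_inner_B (h : PenalizedFlow A D B L_D L_B γ lam β x T) (z : H) :
    ContinuousOn (fun t => lam t * β t * inner ℝ (x t - z) (B (x t))) (Ici 0) :=
  (h.lam_cont.fun_mul h.β_cont).fun_mul ((h.locallyAC.sub_const z).continuousOn.inner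
    ((h.cocoercive_B.continuous h.L_B_pos).comp_continuousOn h.locallyAC.continuousOn))

theorem norm_sq_le_inner_B (h : PenalizedFlow A D B L_D L_B γ lam β x T)
    (hz : z ∈ zer (single B)) (X : H) : L_B⁻¹ * ‖B X‖ ^ 2 ≤ inner ℝ (X - z) (B X) := by
  have hBz : B z = 0 := (mem_singleton_iff.1 hz).symm
  simpa [hBz] using h.cocoercive_B X z

theorem inner_B_nonneg (h : PenalizedFlow A D B L_D L_B γ lam β x T)
    (hz : z ∈ zer (single B)) (X : H) : 0 ≤ inner ℝ (X - z) (B X) :=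
  le_trans (mul_nonneg (inv_pos.2 h.L_B_pos).le (sq_nonneg _)) (h.norm_sq_le_inner_B hz X)

theorem antitoneOn_γ (h : PenalizedFlow A D B L_D L_B γ lam β x T) : AntitoneOn γ (Ici 0) :=
  h.γ_locallyAC.antitoneOn h.γ_deriv

/-- Both uses rest on this: w = 0 gives dissipation, arbitrary w the ergodic estimate. The modulus η
may be 0 (plain monotonicity). -/
theorem energy_inequality (h : PenalizedFlow A D B L_D L_B γ lam β x T)
    (hp : p ∈ normalCone (zer (single B)) z) (hw : w = v + D z + p)
    (hmono : ∀ y, ∀ r ∈ A y, η * ‖y - z‖ ^ 2 ≤ inner ℝ (y - z) (r - v)) :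
    ∀ᵐ t ∂volume.restrict (Ioi T),
      deriv (energy γ x z) t + 9 / 16 * ‖timeDeriv (timeDeriv x) t‖ ^ 2 +
          1 / 8 * ‖timeDeriv x t‖ ^ 2 + 1 / 8 * (lam t * β t * inner ℝ (x t - z) (B (x t))) +
          lam t * (η * ‖timeDeriv (timeDeriv x) t + γ t • timeDeriv x t + x t - z‖ ^ 2) ≤
        forcing B lam β x z p w t + lam t * inner ℝ (z - x t) w := by
  -- Genuine differentiability is required: where it fails, `timeDeriv γ` is the default 0 and its
  -- sign says nothing.
  have hγd : ∀ᵐ t ∂volume.restrict (Ioi (0 : ℝ)), DifferentiableAt ℝ γ t := by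
    rw [ae_restrict_iff' measurableSet_Ioi]
    have hall : ∀ᵐ t : ℝ, ∀ n : ℕ, t ∈ uIcc (0 : ℝ) n → DifferentiableAt ℝ γ t :=
      ae_all_iff.2 fun n => (h.γ_locallyAC.on_interval le_rfl n.cast_nonneg).ae_differentiableAt
    filter_upwards [hall] with t ht ht0
    obtain ⟨n, hn⟩ := exists_nat_ge t
    exact ht n (by rw [uIcc_of_le n.cast_nonneg]; exact ⟨(mem_Ioi.1 ht0).le, hn⟩)
  have hγ' := h.γ_deriv
  rw [← restrict_Ioi_eq_restrict_Ici] at hγ'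
  filter_upwards [h.ae_Ioi_T hγd, h.ae_Ioi_T hγ', h.ae_Ioi_T h.inclusion,
    ae_restrict_mem measurableSet_Ioi] with t h1 h2 ⟨h3, h4, r, hr, hlr⟩ ht
  have ht0 : 0 < t := h.T_nonneg.trans_lt ht
  rw [timeDeriv_eq_deriv _ ht0] at h2
  have hE := deriv_energy_le (z := z) (h.sqrt_two_le t ht0.le) h1 h2 h3 h4
  have hest := penalized_inclusion_estimate (h.lam_pos t ht0.le) (h.β_pos t ht0.le) h.L_D_pos
    h.L_B_pos (h.step_D t (le_of_lt ht)) (h.step_B t (le_of_lt ht)) hlr (hmono _ r hr)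
    (h.cocoercive_D (x t) z) (h.norm_sq_le_inner_B hp.1 (x t)) hw
  have hmax := le_max_left
    (8 * lam t * inner ℝ (x t - z) p - lam t * β t * inner ℝ (x t - z) (B (x t))) 0
  rw [forcing]
  linarith

theorem integrableOn_forcing (h : PenalizedFlow A D B L_D L_B γ lam β x T)
    (hp : p ∈ normalCone (zer (single B)) z) (w : H) :
    IntegrableOn (forcing B lam β x z p w) (Ioi T) :=
  (SecondOrderDyn.integrableOn_forcing h.lam_pos h.β_pos h.lam_cont h.β_cont h.lam_L2 h.fitz
    (h.cocoercive_B.continuous h.L_B_pos) h.locallyAC.continuousOn hp w).mono_set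
    fun _ ht => h.T_nonneg.trans (le_of_lt ht)

theorem locallyAC_energy (h : PenalizedFlow A D B L_D L_B γ lam β x T) (z : H) :
    LocallyAC (energy γ x z) :=
  SecondOrderDyn.locallyAC_energy h.γ_locallyAC h.locallyAC h.locallyAC_deriv z

theorem energy_nonneg (h : PenalizedFlow A D B L_D L_B γ lam β x T) (z : H) (t : ℝ) (ht : T ≤ t) :
    0 ≤ energy γ x z t :=
  SecondOrderDyn.energy_nonneg z (h.sqrt_two_le t (h.T_nonneg.trans ht))

/-- At a zero of `A + D + N_C` the energy converges and every dissipation term is integrable. -/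
theorem dissipation [CompleteSpace H] (h : PenalizedFlow A D B L_D L_B γ lam β x T)
    (hp : p ∈ normalCone (zer (single B)) z) (hw : 0 = v + D z + p) (hη : 0 ≤ η)
    (hmono : ∀ y, ∀ r ∈ A y, η * ‖y - z‖ ^ 2 ≤ inner ℝ (y - z) (r - v)) :
    (∃ l, Tendsto (energy γ x z) atTop (𝓝 l)) ∧
      IntegrableOn (fun t => ‖timeDeriv (timeDeriv x) t‖ ^ 2) (Ioi T) ∧
      IntegrableOn (fun t => ‖timeDeriv x t‖ ^ 2) (Ioi T) ∧
      IntegrableOn (fun t => lam t * β t * inner ℝ (x t - z) (B (x t))) (Ioi T) ∧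
      IntegrableOn (fun t =>
        lam t * (η * ‖timeDeriv (timeDeriv x) t + γ t • timeDeriv x t + x t - z‖ ^ 2))
        (Ioi T) := by
  have hsub : Ioi T ⊆ Ici 0 := fun t ht => h.T_nonneg.trans (le_of_lt ht)
  have hineq : ∀ᵐ t ∂volume.restrict (Ioi T),
      (0 ≤ lam t * β t * inner ℝ (x t - z) (B (x t)) ∧
        0 ≤ lam t * (η * ‖timeDeriv (timeDeriv x) t + γ t • timeDeriv x t + x t - z‖ ^ 2)) ∧
      deriv (energy γ x z) t + 9 / 16 * ‖timeDeriv (timeDeriv x) t‖ ^ 2 +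
          1 / 8 * ‖timeDeriv x t‖ ^ 2 + 1 / 8 * (lam t * β t * inner ℝ (x t - z) (B (x t))) +
          lam t * (η * ‖timeDeriv (timeDeriv x) t + γ t • timeDeriv x t + x t - z‖ ^ 2) ≤
        forcing B lam β x z p 0 t := by
    filter_upwards [h.energy_inequality hp hw hmono, ae_restrict_mem measurableSet_Ioi]
      with t h1 ht
    have hlam := h.lam_pos t (hsub ht)
    have hβ := h.β_pos t (hsub ht)
    rw [inner_zero_right, mul_zero, add_zero] at h1
    exact ⟨⟨mul_nonneg (by positivity) (h.inner_B_nonneg hp.1 _), by positivity⟩, h1⟩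
  have hE := h.locallyAC_energy z
  have hG := h.integrableOn_forcing hp 0
  have key : ∀ {g : ℝ → ℝ}, AEStronglyMeasurable g (volume.restrict (Ici (0 : ℝ))) →
      (∀ᵐ t ∂volume.restrict (Ioi T), 0 ≤ g t) →
      (∀ᵐ t ∂volume.restrict (Ioi T), g t + deriv (energy γ x z) t ≤ forcing B lam β x z p 0 t) →
      IntegrableOn g (Ioi T) := fun hg =>
    hE.integrableOn_of_le_sub_deriv h.T_nonneg (h.energy_nonneg z) hG (hg.mono_set hsub)
  have hxm := h.locallyAC.continuousOn.aestronglyMeasurable (μ := volume) measurableSet_Ici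
  have hx'm := h.locallyAC_deriv.continuousOn.aestronglyMeasurable (μ := volume) measurableSet_Ici
  have hγm := h.γ_locallyAC.continuousOn.aestronglyMeasurable (μ := volume) measurableSet_Ici
  have hlm := h.lam_cont.aestronglyMeasurable (μ := volume) measurableSet_Ici
  have h''m := (aestronglyMeasurable_accel x)
  refine ⟨hE.exists_tendsto_of_deriv_le h.T_nonneg (h.energy_nonneg z) hG ?_, ?_, ?_, ?_, ?_⟩
  · filter_upwards [hineq] with t ⟨⟨h1, h2⟩, h3⟩
    have := sq_nonneg ‖timeDeriv (timeDeriv x) t‖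
    have := sq_nonneg ‖timeDeriv x t‖
    linarith
  · have := key (g := fun t => 9 / 16 * ‖timeDeriv (timeDeriv x) t‖ ^ 2)
      ((h''m.norm.pow 2).const_mul _) (ae_of_all _ fun t => by positivity) (by
        filter_upwards [hineq] with t ⟨⟨h1, h2⟩, h3⟩
        have := sq_nonneg ‖timeDeriv x t‖
        linarith)
    exact (Integrable.const_mul this (16 / 9)).congr (ae_of_all _ fun t => by ring)
  · have := key (g := fun t => 1 / 8 * ‖timeDeriv x t‖ ^ 2)
      ((hx'm.norm.pow 2).const_mul _) (ae_of_all _ fun t => by positivity) (by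
        filter_upwards [hineq] with t ⟨⟨h1, h2⟩, h3⟩
        have := sq_nonneg ‖timeDeriv (timeDeriv x) t‖
        linarith)
    exact (Integrable.const_mul this 8).congr (ae_of_all _ fun t => by ring)
  · have := key (g := fun t => 1 / 8 * (lam t * β t * inner ℝ (x t - z) (B (x t))))
      (((h.continuousOn_inner_B z).aestronglyMeasurable measurableSet_Ici).const_mul _) (by
        filter_upwards [hineq] with t ⟨⟨h1, h2⟩, h3⟩
        positivity) (by
        filter_upwards [hineq] with t ⟨⟨h1, h2⟩, h3⟩
        have := sq_nonneg ‖timeDeriv (timeDeriv x) t‖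
        have := sq_nonneg ‖timeDeriv x t‖
        linarith)
    exact (Integrable.const_mul this 8).congr (ae_of_all _ fun t => by ring)
  · refine key (hlm.mul ((((((h''m.add (hγm.smul hx'm)).add hxm).sub
      aestronglyMeasurable_const).norm.pow 2).const_mul _))) ?_ ?_
    · filter_upwards [hineq] with t ⟨⟨h1, h2⟩, h3⟩ using h2
    · filter_upwards [hineq] with t ⟨⟨h1, h2⟩, h3⟩
      have := sq_nonneg ‖timeDeriv (timeDeriv x) t‖
      have := sq_nonneg ‖timeDeriv x t‖
      change lam t * (η * ‖timeDeriv (timeDeriv x) t + γ t • timeDeriv x t + x t - z‖ ^ 2) + _ ≤ _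
      linarith

/-- The function ‖x'‖² is integrable, and its derivative 2⟨x', x''⟩ is at most the integrable ‖x'‖²
+ ‖x''‖². -/
theorem tendsto_velocity (h : PenalizedFlow A D B L_D L_B γ lam β x T)
    (h2 : IntegrableOn (fun t => ‖timeDeriv (timeDeriv x) t‖ ^ 2) (Ioi T))
    (h1 : IntegrableOn (fun t => ‖timeDeriv x t‖ ^ 2) (Ioi T)) :
    Tendsto (timeDeriv x) atTop (𝓝 0) := by
  have hsq : Tendsto (fun t => ‖timeDeriv x t‖ ^ 2) atTop (𝓝 0) := by
    refine h.locallyAC_deriv.norm_sq.tendsto_zero_of_integrableOn h.T_nonneg h1 (h1.add h2) ?_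
      fun t _ => sq_nonneg _
    filter_upwards [h.ae_Ioi_T h.inclusion] with t ⟨_, h4, _⟩
    have hd : deriv (fun t => ‖timeDeriv x t‖ ^ 2) t = _ := h4.norm_sq.deriv
    rw [hd]
    change _ ≤ ‖timeDeriv x t‖ ^ 2 + ‖timeDeriv (timeDeriv x) t‖ ^ 2
    have := real_inner_le_norm (timeDeriv x t) (timeDeriv (timeDeriv x) t)
    nlinarith [sq_nonneg (‖timeDeriv x t‖ - ‖timeDeriv (timeDeriv x) t‖)]
  rw [tendsto_zero_iff_norm_tendsto_zero]
  simpa [Real.sqrt_sq] using hsq.sqrt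

theorem exists_norm_bound_of_energy (h : PenalizedFlow A D B L_D L_B γ lam β x T)
    {l : ℝ} (hl : Tendsto (energy γ x z) atTop (𝓝 l)) :
    ∃ R, ∀ t, 0 ≤ t → ‖x t - z‖ ≤ R := by
  obtain ⟨S, hS⟩ := eventually_atTop.1 (hl.eventually_lt_const (lt_add_one l))
  obtain ⟨C, hC⟩ := (isCompact_Icc (a := (0 : ℝ)) (b := max S 0)).exists_bound_of_continuousOn
    ((h.locallyAC.sub_const z).continuousOn.mono Icc_subset_Ici_self)
  refine ⟨max C (√(10 * (l + 1))), fun t ht => ?_⟩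
  rcases le_total t (max S 0) with hts | hts
  · exact (hC t ⟨ht, hts⟩).trans (le_max_left _ _)
  · refine le_trans (Real.le_sqrt_of_sq_le ?_) (le_max_right _ _)
    have h1 := le_energy (x := x) z (h.sqrt_two_le t ht)
    have h2 := hS t ((le_max_left _ _).trans hts)
    have := sq_nonneg ‖timeDeriv x t‖
    linarith

theorem tendsto_inner_velocity (h : PenalizedFlow A D B L_D L_B γ lam β x T)
    {l : ℝ} (hl : Tendsto (energy γ x z) atTop (𝓝 l))
    (hv : Tendsto (timeDeriv x) atTop (𝓝 0)) :
    Tendsto (fun t => inner ℝ (x t - z) (timeDeriv x t)) atTop (𝓝 0) := by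
  obtain ⟨R, hR⟩ := h.exists_norm_bound_of_energy hl
  refine squeeze_zero_norm' (a := fun t => R * ‖timeDeriv x t‖) ?_ ?_
  · filter_upwards [eventually_ge_atTop 0] with t ht
    exact (norm_inner_le_norm _ _).trans (mul_le_mul_of_nonneg_right (hR t ht) (norm_nonneg _))
  · simpa using hv.norm.const_mul R

/-- Solve the definition of the energy for ‖x − z‖²: the other terms converge, and γ has a nonzero
limit. -/
theorem exists_tendsto_norm_sub (h : PenalizedFlow A D B L_D L_B γ lam β x T)
    {l : ℝ} (hl : Tendsto (energy γ x z) atTop (𝓝 l))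
    (hv : Tendsto (timeDeriv x) atTop (𝓝 0)) :
    ∃ c, Tendsto (fun t => ‖x t - z‖) atTop (𝓝 c) := by
  obtain ⟨g, hg⟩ := exists_tendsto_of_antitoneOn h.antitoneOn_γ h.sqrt_two_le
  have hg0 : g ≠ 0 := by
    have : √2 ≤ g := ge_of_tendsto hg ((eventually_ge_atTop 0).mono h.sqrt_two_le)
    have := sqrt_two_gt
    intro h0
    linarith
  have h1 := (hl.sub (h.tendsto_inner_velocity hl hv)).sub
    ((hg.mul (hv.norm.pow 2)).const_mul (9 / 16))
  have h2 := ((h1.div hg hg0).const_mul 2).sqrt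
  refine ⟨_, h2.congr' ?_⟩
  filter_upwards [eventually_ge_atTop 0] with t ht
  have hγt : γ t ≠ 0 := by
    have := h.sqrt_two_le t ht
    have := sqrt_two_gt
    intro h0
    linarith
  have heq : 2 * ((energy γ x z t - inner ℝ (x t - z) (timeDeriv x t) -
      9 / 16 * (γ t * ‖timeDeriv x t‖ ^ 2)) / γ t) = ‖x t - z‖ ^ 2 := by
    rw [energy]
    field_simp
    ring
  change √(2 * ((energy γ x z t - inner ℝ (x t - z) (timeDeriv x t) -
      9 / 16 * (γ t * ‖timeDeriv x t‖ ^ 2)) / γ t)) = _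
  rw [heq, Real.sqrt_sq (norm_nonneg _)]

/-- The energy argument only reaches times after T; on [0, T] the acceleration is dominated a.e. by
a continuous function. -/
theorem integrableOn_norm_sq_accel [CompleteSpace H]
    (h : PenalizedFlow A D B L_D L_B γ lam β x T) (hv : v ∈ A z) (hA : MonotoneOp A)
    (h2 : IntegrableOn (fun t => ‖timeDeriv (timeDeriv x) t‖ ^ 2) (Ioi T)) :
    IntegrableOn (fun t => ‖timeDeriv (timeDeriv x) t‖ ^ 2) (Ici 0) := by
  rw [← Icc_union_Ioi_eq_Ici h.T_nonneg]
  refine IntegrableOn.union ?_ h2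
  have hxc := h.locallyAC.continuousOn
  set b : ℝ → ℝ := fun t => 2 * ‖x t - z‖ +
    (lam t * ‖D (x t)‖ + lam t * β t * ‖B (x t)‖ + lam t * ‖v‖) + γ t * ‖timeDeriv x t‖
  have hb : ContinuousOn b (Ici 0) := by
    have hDx := (h.cocoercive_D.continuous h.L_D_pos).comp_continuousOn hxc
    have hBx := (h.cocoercive_B.continuous h.L_B_pos).comp_continuousOn hxc
    have hlc := h.lam_cont
    exact ((continuousOn_const.mul (hxc.sub continuousOn_const).norm).add
      (((hlc.mul hDx.norm).add ((hlc.mul h.β_cont).mul hBx.norm)).add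
        (hlc.mul continuousOn_const))).add
      (h.γ_locallyAC.continuousOn.mul h.locallyAC_deriv.continuousOn.norm)
  refine Integrable.mono' (g := fun t => b t ^ 2)
    ((hb.mono Icc_subset_Ici_self).fun_pow 2).integrableOn_Icc
    (((aestronglyMeasurable_accel x).norm.pow 2).mono_set Icc_subset_Ici_self) ?_
  rw [← restrict_Ioc_eq_restrict_Icc]
  filter_upwards [ae_restrict_of_ae_restrict_of_subset (fun t ht => ht.1) h.inclusion,
    ae_restrict_mem measurableSet_Ioc] with t ⟨_, _, r, hr, hlr⟩ ht
  have ht0 := ht.1.le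
  have h1 := norm_le_of_penalized_inclusion (z := z) (v := v) (h.lam_pos t ht0) (h.β_pos t ht0) hlr
    (hA _ _ r hr v hv)
  have hγ0 : 0 ≤ γ t := (Real.sqrt_nonneg _).trans (h.sqrt_two_le t ht0)
  have h3 : ‖timeDeriv (timeDeriv x) t‖ ≤ b t := by
    have := norm_sub_le (timeDeriv (timeDeriv x) t + γ t • timeDeriv x t) (γ t • timeDeriv x t)
    rw [add_sub_cancel_right, norm_smul, Real.norm_of_nonneg hγ0] at this
    change _ ≤ 2 * ‖x t - z‖ + _ + γ t * ‖timeDeriv x t‖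
    linarith
  rw [Real.norm_of_nonneg (sq_nonneg _)]
  exact pow_le_pow_left₀ (norm_nonneg _) h3 2

/-- Drop the dissipation and integrate the energy inequality from T: the energy is nonnegative and
the forcing integrable. -/
theorem exists_lower_bound_integral (h : PenalizedFlow A D B L_D L_B γ lam β x T)
    (hp : p ∈ normalCone (zer (single B)) z) (hw : w = v + D z + p)
    (hmono : ∀ y, ∀ r ∈ A y, 0 ≤ inner ℝ (y - z) (r - v)) :
    ∃ K, ∀ t, T ≤ t → K ≤ ∫ s in (0 : ℝ)..t, lam s * inner ℝ (z - x s) w := by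
  have hG := h.integrableOn_forcing hp w
  have hc : ContinuousOn (fun s => lam s * inner ℝ (z - x s) w) (Ici 0) :=
    h.lam_cont.fun_mul ((continuousOn_const.fun_sub h.locallyAC.continuousOn).inner
      continuousOn_const)
  have hle : ∀ᵐ t ∂volume.restrict (Ioi T), deriv (energy γ x z) t ≤
      forcing B lam β x z p w t + lam t * inner ℝ (z - x t) w := by
    filter_upwards [h.energy_inequality (η := 0) hp hw (by simpa using hmono),
      ae_restrict_mem measurableSet_Ioi] with t h1 ht
    have ht0 : 0 ≤ t := h.T_nonneg.trans (le_of_lt ht)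
    have := sq_nonneg ‖timeDeriv (timeDeriv x) t‖
    have := sq_nonneg ‖timeDeriv x t‖
    have := mul_nonneg (mul_nonneg (h.lam_pos t ht0).le (h.β_pos t ht0).le)
      (h.inner_B_nonneg hp.1 (x t))
    linarith
  refine ⟨(∫ s in (0 : ℝ)..T, lam s * inner ℝ (z - x s) w) - energy γ x z T -
    ∫ s in Ioi T, ‖forcing B lam β x z p w s‖, fun t ht => ?_⟩
  have hGi := intervalIntegrable_of_integrableOn_Ioi hG le_rfl ht
  have hci := hc.intervalIntegrable_of_nonneg h.T_nonneg (h.T_nonneg.trans ht)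
  have h1 := (h.locallyAC_energy z).sub_le_integral h.T_nonneg hle le_rfl ht (hGi.add hci)
  rw [intervalIntegral.integral_add hGi hci] at h1
  have h2 := h.energy_nonneg z t ht
  have h3 := intervalIntegral.integral_add_adjacent_intervals
    (hc.intervalIntegrable_of_nonneg le_rfl h.T_nonneg) hci
  have h4 : ∫ s in T..t, forcing B lam β x z p w s ≤
      ∫ s in Ioi T, ‖forcing B lam β x z p w s‖ := by
    rw [intervalIntegral.integral_of_le ht]
    refine (Real.le_norm_self _).trans ((norm_integral_le_integral_norm _).trans ?_)
    exact setIntegral_mono_set hG.norm (ae_of_all _ fun _ => norm_nonneg _)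
      (ae_of_all _ fun s hs => hs.1)
  linarith

/-- Dividing the lower bound by ∫λ → ∞ makes it vanish, while the left-over average tends to ⟨z − b,
w⟩. -/
theorem inner_nonneg_of_weak_cluster [CompleteSpace H]
    (h : PenalizedFlow A D B L_D L_B γ lam β x T) (hlam : ¬ IntegrableOn lam (Ici 0))
    (hp : p ∈ normalCone (zer (single B)) z) (hw : w = v + D z + p)
    (hmono : ∀ y, ∀ r ∈ A y, 0 ≤ inner ℝ (y - z) (r - v)) {l : Filter ℝ} [l.NeBot]
    (hl : l ≤ atTop) {b : H}
    (hb : Tendsto (fun t => inner ℝ (ergodicAverage lam x t) w) l (𝓝 (inner ℝ b w))) :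
    0 ≤ inner ℝ (z - b) w := by
  obtain ⟨K, hK⟩ := h.exists_lower_bound_integral hp hw hmono
  have hΛ := tendsto_integral_atTop_of_not_integrable h.lam_pos h.lam_cont hlam
  have h0 : Tendsto (fun t => (∫ s in (0 : ℝ)..t, lam s)⁻¹ * K) l (𝓝 0) := by
    simpa using ((tendsto_inv_atTop_zero.comp hΛ).mul_const K).mono_left hl
  have h1 : Tendsto (fun t => inner ℝ z w - inner ℝ (ergodicAverage lam x t) w) l
      (𝓝 (inner ℝ (z - b) w)) := by
    rw [inner_sub_left]
    exact tendsto_const_nhds.sub hb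
  refine le_of_tendsto_of_tendsto h0 h1 (hl ?_)
  filter_upwards [eventually_gt_atTop T] with t ht
  have ht0 : 0 < t := h.T_nonneg.trans_lt ht
  have hxc := h.locallyAC.continuousOn
  rw [inner_ergodicAverage h.lam_cont hxc w ht0.le,
    ← ergodicAverage_const h.lam_pos h.lam_cont (inner ℝ z w) ht0,
    ← ergodicAverage_sub h.lam_cont continuousOn_const (hxc.inner continuousOn_const) ht0.le]
  simp only [ergodicAverage, smul_eq_mul, ← inner_sub_left]
  exact mul_le_mul_of_nonneg_left (hK t ht.le)
    (inv_pos.2 (integral_pos_of_pos h.lam_pos h.lam_cont ht0)).le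

theorem tendsto_of_strongly_monotone (h : PenalizedFlow A D B L_D L_B γ lam β x T)
    (hlam : ¬ IntegrableOn lam (Ici 0)) (hη : 0 < η)
    (h2 : IntegrableOn (fun t => ‖timeDeriv (timeDeriv x) t‖ ^ 2) (Ioi T))
    (h1 : IntegrableOn (fun t => ‖timeDeriv x t‖ ^ 2) (Ioi T))
    (h3 : IntegrableOn (fun t =>
      lam t * (η * ‖timeDeriv (timeDeriv x) t + γ t • timeDeriv x t + x t - z‖ ^ 2)) (Ioi T))
    {c : ℝ} (hc : Tendsto (fun t => ‖x t - z‖) atTop (𝓝 c)) : Tendsto x atTop (𝓝 z) := by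
  have hlx : ContinuousOn (fun t => lam t * ‖x t - z‖ ^ 2) (Ici 0) :=
    h.lam_cont.fun_mul ((h.locallyAC.sub_const z).continuousOn.norm.pow 2)
  -- Strong monotonicity controls x'' + γx' + x − z; the passage to x − z costs ‖x''‖² and
  -- γ(0)²‖x'‖², integrable with the bounded factor λ ≤ 1/(8L_D).
  have hint : IntegrableOn (fun t => lam t * ‖x t - z‖ ^ 2) (Ioi T) := by
    refine Integrable.mono' (((h3.const_mul (2 * η⁻¹)).add
      (h2.const_mul (4 * (8 * L_D)⁻¹))).add (h1.const_mul (4 * (8 * L_D)⁻¹ * γ 0 ^ 2)))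
      ((hlx.aestronglyMeasurable measurableSet_Ici).mono_set
        fun t ht => h.T_nonneg.trans (le_of_lt ht)) ?_
    filter_upwards [ae_restrict_mem measurableSet_Ioi] with t ht
    have ht0 : 0 ≤ t := h.T_nonneg.trans (le_of_lt ht)
    have hl0 := h.lam_pos t ht0
    have hLD := h.L_D_pos
    have hγ0 : 0 ≤ γ t := (Real.sqrt_nonneg _).trans (h.sqrt_two_le t ht0)
    have hl1 : lam t ≤ (8 * L_D)⁻¹ := by
      rw [← one_div, le_div_iff₀ (by positivity)]
      have := h.step_D t (le_of_lt ht)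
      linarith
    have hγ1 : γ t ≤ γ 0 := h.antitoneOn_γ (mem_Ici.2 le_rfl) ht0 ht0
    rw [Real.norm_of_nonneg (by positivity)]
    simp only [Pi.add_apply]
    set a := timeDeriv (timeDeriv x) t
    set u := timeDeriv x t
    have e1 : ‖x t - z‖ ≤ ‖a + γ t • u + x t - z‖ + (‖a‖ + γ 0 * ‖u‖) := by
      rw [show x t - z = (a + γ t • u + x t - z) - (a + γ t • u) by abel]
      refine (norm_sub_le _ _).trans (add_le_add le_rfl ?_)
      refine (norm_add_le _ _).trans (add_le_add le_rfl ?_)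
      rw [norm_smul, Real.norm_of_nonneg hγ0]
      exact mul_le_mul_of_nonneg_right hγ1 (norm_nonneg _)
    set q := ‖a + γ t • u + x t - z‖
    have e2 : ‖x t - z‖ ^ 2 ≤ 2 * q ^ 2 + 4 * (‖a‖ ^ 2 + γ 0 ^ 2 * ‖u‖ ^ 2) := by
      refine (pow_le_pow_left₀ (norm_nonneg _) e1 2).trans ?_
      nlinarith [sq_nonneg (q - (‖a‖ + γ 0 * ‖u‖)), sq_nonneg (‖a‖ - γ 0 * ‖u‖)]
    have e3 := mul_le_mul_of_nonneg_left e2 hl0.le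
    have e4 := mul_le_mul_of_nonneg_right hl1
      (by positivity : 0 ≤ 4 * (‖a‖ ^ 2 + γ 0 ^ 2 * ‖u‖ ^ 2))
    have e5 : 2 * η⁻¹ * (lam t * (η * q ^ 2)) = lam t * (2 * q ^ 2) := by
      field_simp
    rw [e5]
    linarith
  -- If c > 0, then eventually λ ≤ (c/2)⁻² λ‖x − z‖², which would make λ integrable.
  have hc0 : c = 0 := by
    by_contra hne
    have hcpos : 0 < c :=
      lt_of_le_of_ne (ge_of_tendsto' hc fun t => norm_nonneg _) (Ne.symm hne)
    obtain ⟨S, hS⟩ := eventually_atTop.1 (hc.eventually_const_lt (half_lt_self hcpos))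
    set S' := max S T
    have hS'0 : 0 ≤ S' := h.T_nonneg.trans (le_max_right _ _)
    refine hlam (integrableOn_Ici_of_Ioi hS'0 h.lam_cont ?_)
    refine Integrable.mono' ((hint.mono_set (Ioi_subset_Ioi (le_max_right S T))).const_mul
      ((c / 2) ^ 2)⁻¹) ((h.lam_cont.aestronglyMeasurable measurableSet_Ici).mono_set
        fun t ht => hS'0.trans (le_of_lt ht)) ?_
    filter_upwards [ae_restrict_mem measurableSet_Ioi] with t ht
    have ht0 : 0 ≤ t := hS'0.trans (le_of_lt ht)
    have hl0 := h.lam_pos t ht0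
    have h5 : (c / 2) ^ 2 ≤ ‖x t - z‖ ^ 2 :=
      pow_le_pow_left₀ (by positivity) (hS t ((le_max_left S T).trans (le_of_lt ht))).le 2
    rw [Real.norm_of_nonneg hl0.le, inv_mul_eq_div, le_div_iff₀ (by positivity)]
    exact mul_le_mul_of_nonneg_left h5 hl0.le
  rw [hc0] at hc
  exact tendsto_iff_norm_sub_tendsto_zero.2 hc

end PenalizedFlow

end Asymptotics

/-! ### Zeros of A + D + N_C. -/

section Zeros

variable {H : Type*} [NormedAddCommGroup H] [InnerProductSpace ℝ H]

theorem mem_zer_add_normalCone {A : H → Set H} {D : H → H} {C : Set H} {z : H} :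
    z ∈ zer (fun y => A y + {D y} + normalCone C y) ↔
      ∃ v ∈ A z, ∃ p ∈ normalCone C z, 0 = v + D z + p := by
  constructor
  · rintro ⟨_, ⟨v, hv, d, hd, rfl⟩, p, hp, h⟩
    rw [mem_singleton_iff] at hd
    exact ⟨v, hv, p, hp, by rw [← h, hd]⟩
  · rintro ⟨v, hv, p, hp, h⟩
    exact ⟨v + D z, ⟨v, hv, D z, rfl, rfl⟩, p, hp, h.symm⟩

theorem inner_normalCone_nonneg {C : Set H} {z z' p p' : H} (hp : p ∈ normalCone C z)
    (hp' : p' ∈ normalCone C z') : 0 ≤ inner ℝ (z - z') (p - p') := by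
  have h1 := hp.2 z' hp'.1
  have h2 := hp'.2 z hp.1
  rw [← neg_sub z z', inner_neg_left] at h1
  rw [inner_sub_right]
  linarith

theorem eq_of_mem_zer_of_strongly_monotone {A : H → Set H} {D : H → H} {C : Set H} {c η : ℝ}
    (hc : 0 ≤ c) (hD : Cocoercive c D) (hη : 0 < η)
    (hA : ∀ x y, ∀ u ∈ A x, ∀ v ∈ A y, η * ‖x - y‖ ^ 2 ≤ inner ℝ (x - y) (u - v)) {z z' : H}
    (hz : z ∈ zer (fun y => A y + {D y} + normalCone C y))
    (hz' : z' ∈ zer (fun y => A y + {D y} + normalCone C y)) : z = z' := by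
  obtain ⟨v, hv, p, hp, hw⟩ := mem_zer_add_normalCone.1 hz
  obtain ⟨v', hv', p', hp', hw'⟩ := mem_zer_add_normalCone.1 hz'
  have h1 := hA z z' v hv v' hv'
  have h2 := hD.inner_nonneg hc z z'
  have h3 := inner_normalCone_nonneg hp hp'
  have h4 : v - v' = -(D z - D z') - (p - p') := by
    have e : v - v' = (v + D z + p) - (v' + D z' + p') - (D z - D z') - (p - p') := by abel
    rw [e, ← hw, ← hw', sub_self, zero_sub]
  rw [h4, inner_sub_right, inner_neg_right] at h1
  have h5 : ‖z - z'‖ ^ 2 = 0 := by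
    have : η * ‖z - z'‖ ^ 2 ≤ 0 := by linarith
    nlinarith [sq_nonneg ‖z - z'‖]
  simpa [sub_eq_zero] using h5

theorem timeDeriv_half_norm_sub_sq {x : ℝ → H} (hx : DifferentiableOn ℝ x (Ici 0)) (z : H) {t : ℝ}
    (ht : 0 < t) :
    timeDeriv (fun t => (1 / 2 : ℝ) * ‖x t - z‖ ^ 2) t = inner ℝ (x t - z) (timeDeriv x t) := by
  have hd : HasDerivAt x (timeDeriv x t) t :=
    (hx t ht.le).hasDerivWithinAt.hasDerivAt (Ici_mem_nhds ht)
  have h := ((hd.sub_const z).norm_sq.const_mul (1 / 2)).deriv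
  rw [timeDeriv_eq_deriv _ ht]
  refine h.trans ?_
  ring

end Zeros

/-! ### The time after which the parameters are small enough. -/

section Threshold

theorem exists_step_threshold {lam β : ℝ → ℝ} {L_D L_B : ℝ} (hL_D : 0 < L_D) (hL_B : 0 < L_B)
    (hlam_lim : Tendsto lam atTop (𝓝 0))
    (hlimsup : limsup (fun t => ((lam t * β t : ℝ) : EReal)) atTop < ((1 / L_B : ℝ) : EReal)) :
    ∃ T, 0 ≤ T ∧ ∀ t, T ≤ t → lam t * L_D ≤ 1 / 8 ∧ lam t * β t * L_B ≤ 1 := by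
  have h1 : ∀ᶠ t in atTop, lam t < 1 / 8 / L_D := hlam_lim.eventually_lt_const (by positivity)
  have h2 := eventually_lt_of_limsup_lt hlimsup
  obtain ⟨T, hT⟩ := eventually_atTop.1 (h1.and h2)
  refine ⟨max T 0, le_max_right _ _, fun t ht => ?_⟩
  obtain ⟨h3, h4⟩ := hT t ((le_max_left _ _).trans ht)
  rw [EReal.coe_lt_coe_iff] at h4
  exact ⟨((lt_div_iff₀ hL_D).1 h3).le, ((lt_div_iff₀ hL_B).1 h4).le⟩

end Threshold

end SecondOrderDyn

/-! ### Assembly of the theorem. -/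

open SecondOrderDyn
theorem theorem2 {H : Type*} [NormedAddCommGroup H] [InnerProductSpace ℝ H] [CompleteSpace H]
    -- the operators
    (A : H → Set H) (hA : MaximallyMonotone A)
    (D B : H → H) (L_D L_B : ℝ) (hL_D : 0 < L_D) (hL_B : 0 < L_B)
    (hD : Cocoercive L_D⁻¹ D) (hB : Cocoercive L_B⁻¹ B)
    -- `C = zer B` and `M = A + D + N_C`
    (C : Set H) (hC : C = zer (single B))
    (M : H → Set H) (hM : M = fun y => A y + {D y} + normalCone C y)
    -- (H1)
    (γ lam β : ℝ → ℝ)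
    (hγ_pos : ∀ t, 0 ≤ t → 0 < γ t) (hlam_pos : ∀ t, 0 ≤ t → 0 < lam t)
    (hβ_pos : ∀ t, 0 ≤ t → 0 < β t)
    (hγ_cont : ContinuousOn γ (Ici 0)) (hlam_cont : ContinuousOn lam (Ici 0))
    (hβ_cont : ContinuousOn β (Ici 0))
    -- (H2)
    (hmax : MaximallyMonotone fun y => A y + normalCone C y) (hzer : (zer M).Nonempty)
    -- (H3)
    (hlam_L2 : MemLp lam 2 (volume.restrict (Ici (0 : ℝ))))
    (hlam_L1 : ¬ MemLp lam 1 (volume.restrict (Ici (0 : ℝ))))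
    (hlam_lim : Tendsto lam atTop (𝓝 0))
    -- (H_fitz)
    (hfitz : FitzCondition B lam β)
    -- the trajectory
    (u₀ v₀ : H) (x : ℝ → H) (hx : IsStrongGlobalSolution A D B γ lam β u₀ v₀ x)
    -- the additional hypotheses on the parameters
    (hlimsup : limsup (fun t => ((lam t * β t : ℝ) : EReal)) atTop < ((1 / L_B : ℝ) : EReal))
    (hγ_ac : LocallyAC γ)
    (hγ : ∀ᵐ t ∂(volume.restrict (Ici (0 : ℝ))), √2 ≤ γ t ∧ timeDeriv γ t ≤ 0) :
    -- (i)
    ((∀ z ∈ zer M,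
        (∃ l : ℝ, Tendsto (fun t => ‖x t - z‖) atTop (𝓝 l)) ∧
        IntegrableOn (fun t => lam t * β t * inner ℝ (B (x t)) (x t - z)) (Ici (0 : ℝ)) ∧
        Tendsto (timeDeriv fun t => (1 / 2 : ℝ) * ‖x t - z‖ ^ 2) atTop (𝓝 0)) ∧
      MemLp (timeDeriv x) 2 (volume.restrict (Ici (0 : ℝ))) ∧
      MemLp (timeDeriv (timeDeriv x)) 2 (volume.restrict (Ici (0 : ℝ))) ∧
      IntegrableOn (fun t => lam t * β t * ‖B (x t)‖ ^ 2) (Ici (0 : ℝ)) ∧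
      Tendsto (timeDeriv x) atTop (𝓝 0)) ∧
    -- (ii)
    (∃ z ∈ zer M,
      Tendsto (fun t => toWeakSpace ℝ H (ergodicAverage lam x t)) atTop
        (𝓝 (toWeakSpace ℝ H z))) ∧
    -- (iii)
    (StronglyMonotone A → ∃ z, zer M = {z} ∧ Tendsto x atTop (𝓝 z)) := by

  subst hC hM
  obtain ⟨T, hT0, hT⟩ := exists_step_threshold hL_D hL_B hlam_lim hlimsup
  have hflow : PenalizedFlow A D B L_D L_B γ lam β x T :=
    { L_D_pos := hL_D
      L_B_pos := hL_B
      cocoercive_D := hD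
      cocoercive_B := hB
      lam_pos := hlam_pos
      β_pos := hβ_pos
      lam_cont := hlam_cont
      β_cont := hβ_cont
      lam_L2 := hlam_L2
      fitz := hfitz
      γ_locallyAC := hγ_ac
      sqrt_two_le := fun t ht => le_of_ae_le hγ_cont (hγ.mono fun t ht => ht.1) ht
      γ_deriv := hγ.mono fun t ht => ht.2
      locallyAC := hx.locallyAC
      locallyAC_deriv := hx.locallyAC_deriv
      inclusion := hx.ae_inclusion
      T_nonneg := hT0
      step_D := fun t ht => (hT t ht).1
      step_B := fun t ht => (hT t ht).2 }
  have hlam : ¬ IntegrableOn lam (Ici 0) := fun h => hlam_L1 (memLp_one_iff_integrable.2 h)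
  have hmono : ∀ {z v : H}, v ∈ A z → ∀ y, ∀ r ∈ A y, 0 * ‖y - z‖ ^ 2 ≤ inner ℝ (y - z) (r - v) :=
    fun hv y r hr => by simpa using hA.1 _ _ _ hr _ hv
  obtain ⟨z₀, hz₀⟩ := hzer
  obtain ⟨v₀', hv₀, p₀, hp₀, hw₀⟩ := mem_zer_add_normalCone.1 hz₀
  obtain ⟨⟨l₀, hl₀⟩, hacc, hvel, hin, -⟩ := hflow.dissipation hp₀ hw₀ le_rfl (hmono hv₀)
  have hv0 := hflow.tendsto_velocity hacc hvel
  have henergy : ∀ z ∈ zer (fun y => A y + {D y} + normalCone (zer (single B)) y),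
      ∃ l, Tendsto (energy γ x z) atTop (𝓝 l) := fun z hz => by
    obtain ⟨v, hv, p, hp, hw⟩ := mem_zer_add_normalCone.1 hz
    exact (hflow.dissipation hp hw le_rfl (hmono hv)).1
  have hnorm : ∀ z ∈ zer (fun y => A y + {D y} + normalCone (zer (single B)) y),
      ∃ l : ℝ, Tendsto (fun t => ‖x t - z‖) atTop (𝓝 l) := fun z hz => by
    obtain ⟨l, hl⟩ := henergy z hz
    exact hflow.exists_tendsto_norm_sub hl hv0
  have hxc := hx.locallyAC.continuousOn
  refine ⟨⟨fun z hz => ⟨hnorm z hz, ?_, ?_⟩, ?_, ?_, ?_, hv0⟩, ?_, ?_⟩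
  · obtain ⟨v, hv, p, hp, hw⟩ := mem_zer_add_normalCone.1 hz
    simp only [real_inner_comm (x _ - z)]
    exact integrableOn_Ici_of_Ioi hT0 (hflow.continuousOn_inner_B z)
      (hflow.dissipation hp hw le_rfl (hmono hv)).2.2.2.1
  · obtain ⟨l, hl⟩ := henergy z hz
    refine (hflow.tendsto_inner_velocity hl hv0).congr' ?_
    filter_upwards [eventually_gt_atTop 0] with t ht
    exact (timeDeriv_half_norm_sub_sq hx.differentiable z ht).symm
  · have hc := hx.locallyAC_deriv.continuousOn
    exact (memLp_two_iff_integrable_sq_norm (hc.aestronglyMeasurable measurableSet_Ici)).2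
      (integrableOn_Ici_of_Ioi hT0 (hc.norm.fun_pow 2) hvel)
  · exact (memLp_two_iff_integrable_sq_norm (aestronglyMeasurable_accel x)).2
      (hflow.integrableOn_norm_sq_accel hv₀ hA.1 hacc)
  · have hBc : ContinuousOn (fun t => lam t * β t * ‖B (x t)‖ ^ 2) (Ici 0) :=
      (hlam_cont.fun_mul hβ_cont).fun_mul
        (((hB.continuous hL_B).comp_continuousOn hxc).norm.pow 2)
    -- Cocoercivity at z₀, where B vanishes, gives ‖Bx‖² ≤ L_B⟨x − z₀, Bx⟩.
    refine integrableOn_Ici_of_Ioi hT0 hBc (Integrable.mono' (hin.const_mul L_B)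
      ((hBc.aestronglyMeasurable measurableSet_Ici).mono_set
        fun t ht => hT0.trans (le_of_lt ht)) ?_)
    filter_upwards [ae_restrict_mem measurableSet_Ioi] with t ht
    have ht0 : 0 ≤ t := hT0.trans (le_of_lt ht)
    have h1 := mul_pos (hlam_pos t ht0) (hβ_pos t ht0)
    have h2 := hflow.norm_sq_le_inner_B hp₀.1 (x t)
    rw [inv_mul_le_iff₀ hL_B] at h2
    rw [Real.norm_of_nonneg (mul_nonneg h1.le (sq_nonneg _)), mul_left_comm]
    exact mul_le_mul_of_nonneg_left h2 h1.le
  · obtain ⟨R, hR⟩ := hflow.exists_norm_bound_of_energy hl₀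
    have hxR : ∀ t, 0 ≤ t → ‖x t‖ ≤ R + ‖z₀‖ := fun t ht => by
      have := norm_add_le (x t - z₀) z₀
      rw [sub_add_cancel] at this
      linarith [hR t ht]
    obtain ⟨z, hz, hlim⟩ := exists_weak_limit_of_cluster (l := atTop)
      (y := ergodicAverage lam x) (R := R + ‖z₀‖)
      (S := zer (fun y => A y + {D y} + normalCone (zer (single B)) y))
      ((eventually_gt_atTop 0).mono fun t ht => norm_ergodicAverage_le hlam_pos hlam_cont hxR ht)
      (fun 𝒰 h𝒰 b hb => by
        -- The ergodic inequality holds at every graph point of A + N_C with D added, so maximality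
        -- puts −Db in (A + N_C)(b).
        obtain ⟨v, hv, p, hp, hvp⟩ := hmax.neg_mem_of_forall_add_cocoercive hL_D hD (x := b)
          (by
            rintro z _ ⟨v, hv, p, hp, rfl⟩
            refine hflow.inner_nonneg_of_weak_cluster hlam hp (w := v + p + D z) (by abel)
              (fun y r hr => hA.1 _ _ _ hr _ hv) h𝒰 (hb _))
        refine mem_zer_add_normalCone.2 ⟨v, hv, p, hp, ?_⟩
        change v + p = -D b at hvp
        rw [add_right_comm, hvp, neg_add_cancel])
      (fun a ha b hb => by
        obtain ⟨la, hla⟩ := hnorm a ha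
        obtain ⟨lb, hlb⟩ := hnorm b hb
        -- The difference ‖x − b‖² − ‖x − a‖² is affine in ⟨x, a − b⟩, so the latter converges, and
        -- its averages follow.
        have hlim : Tendsto (fun t => inner ℝ (x t) (a - b)) atTop
            (𝓝 (((lb ^ 2 - la ^ 2) + (‖a‖ ^ 2 - ‖b‖ ^ 2)) / 2)) := by
          refine ((((hlb.pow 2).sub (hla.pow 2)).add_const _).div_const 2).congr fun t => ?_
          rw [norm_sub_sq_real, norm_sub_sq_real, inner_sub_right]
          ring
        refine ⟨_, (tendsto_ergodicAverage hlam_pos hlam_cont hlam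
          (hxc.inner continuousOn_const) hlim).congr' ?_⟩
        filter_upwards [eventually_ge_atTop 0] with t ht
        exact (inner_ergodicAverage hlam_cont hxc _ ht).symm)
    exact ⟨z, hz, tendsto_toWeakSpace_of_inner hlim⟩
  · rintro ⟨η, hη, hAη⟩
    refine ⟨z₀, Subset.antisymm (fun z hz => ?_) (singleton_subset_iff.2 hz₀), ?_⟩
    · exact eq_of_mem_zer_of_strongly_monotone (inv_pos.2 hL_D).le hD hη hAη hz hz₀
    · obtain ⟨c, hc⟩ := hnorm z₀ hz₀
      exact hflow.tendsto_of_strongly_monotone hlam hη hacc hvel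
        (hflow.dissipation hp₀ hw₀ hη.le fun y r hr => hAη y z₀ r hr _ hv₀).2.2.2.2 hc
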